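/- Let $F$ be a field of characteristic different from $2$. A form over $F$ means a nondegenerate quadratic form on a finite-dimensional $F$-vector space of positive dimension; a form is hyperbolic if it is isometric to an orthogonal sum of copies of $\langle 1,-1\rangle$, and isotropic if it represents $0$ nontrivially. For a form $q$ over $F$, a field extension $K/F$, and $q_K$ the form $q$ viewed over $K$, put $$D_K(q)=\{a\in K^\times : a \text{ is represented by } q_K\},\qquad G_K(q)=\{a\in K^\times : a q_K\simeq q_K\},$$ $$H_K(q)=\{a\in K^\times : \langle 1,-a\rangle\otimes q_K\simeq q_K\perp -aq_K \text{ is isotropic over } K\}.$$ For a form $p$ over a field $K$ of dimension $n\ge 2$ with $p\not\simeq\langle 1,-1\rangle$, the function field $K(p)$ is the quotient field of the integral domain $K[X_1,\dots,X_n]/(p(X_1,\dots,X_n))$; if $\dim p=1$ or $p\simeq\langle 1,-1\rangle$, put $K(p)=K$. Let $F((x))$ be the field of Laurent series in $x$ over $F$. Let $p$ and $q$ be forms over $F$ of dimension at least two. The following are equivalent: (i) $q$ is hyperbolic over $F(p)$; (ii) $H_K(p)\subseteq G_K(q)$ for every field extension $K/F$; (iii) $q\perp -xq$ is hyperbolic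 over $F((x))(p\perp -xp)$. Furthermore, if $1\in D_F(p)$, the preceding statements are equivalent to each of the following: (iv) $D_K(p)\subseteq G_K(q)$ for every field extension $K/F$; (v) $q\perp -xq$ is hyperbolic over $F((x))(p\perp\langle -x\rangle)$. -/

import Mathlib

universe u v w

noncomputable section

namespace QForm

section General

variable {R : Type u} [CommRing R] {M : Type v} [AddCommGroup M] [Module R M]

/-- The hyperbolic plane `⟨1, -1⟩`. -/
def hyperbolicPlane (R : Type u) [CommRing R] : QuadraticForm R (Fin 2 → R) :=
  QuadraticMap.weightedSumSquares R ![(1 : R), -1]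

/-- A quadratic form is hyperbolic if it is isometric to an orthogonal sum `m × ⟨1, -1⟩`. -/
def IsHyperbolic (q : QuadraticForm R M) : Prop :=
  ∃ m : ℕ, QuadraticMap.Equivalent q (QuadraticMap.pi fun _ : Fin m => hyperbolicPlane R)

/-- The form `q ⊥ -aq`, that is, `⟨1, -a⟩ ⊗ q`. -/
def perpNeg (a : R) (q : QuadraticForm R M) : QuadraticForm R (M × M) :=
  QuadraticMap.prod q ((-a) • q)

/-- The form `q ⊥ ⟨-a⟩`. -/
def perpNegUnary (q : QuadraticForm R M) (a : R) : QuadraticForm R (M × R) :=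
  QuadraticMap.prod q ((-a) • QuadraticMap.sq)

end General

section Field

variable {K : Type u} [Field K] {V : Type v} [AddCommGroup V] [Module K V]

/-- `D_K(q)`: the nonzero values represented by `q`. -/
def D (q : QuadraticForm K V) : Set Kˣ :=
  {a | ∃ x, q x = a}

/-- `G_K(q)`: the similarity factors of `q`. -/
def G (q : QuadraticForm K V) : Set Kˣ :=
  {a | QuadraticMap.Equivalent ((a : K) • q) q}

/-- `H_K(q)`: the nonzero scalars `a` such that `⟨1, -a⟩ ⊗ q = q ⊥ -aq` is isotropic. -/
def H (q : QuadraticForm K V) : Set Kˣ :=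
  {a | ¬ (perpNeg (a : K) q).Anisotropic}

variable [FiniteDimensional K V] [Invertible (2 : K)]

/-- The homogeneous polynomial `p(X₁, …, Xₙ)` of degree two of the quadratic form `p`, with respect
to a basis of the underlying space. -/
def toPoly (p : QuadraticForm K V) : MvPolynomial (Fin (Module.finrank K V)) K :=
  ∑ i, ∑ j, MvPolynomial.C
      (QuadraticMap.associated p (Module.finBasis K V i) (Module.finBasis K V j)) *
    (MvPolynomial.X i * MvPolynomial.X j)

open Classical in
/-- The function field `K(p)`, as a commutative `K`-algebra: `K` itself if `dim p ≤ 1` or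
`p ≃ ⟨1, -1⟩`, and otherwise the ring of fractions of `K[X₁, …, Xₙ] / (p(X₁, …, Xₙ))` (an integral
domain when `p` is nondegenerate). -/
def functionField (p : QuadraticForm K V) : CommAlgCat.{u} K :=
  if Module.finrank K V ≤ 1 ∨ QuadraticMap.Equivalent p (hyperbolicPlane K) then
    CommAlgCat.of K K
  else
    CommAlgCat.of K (FractionRing
      (MvPolynomial (Fin (Module.finrank K V)) K ⧸ Ideal.span {toPoly p}))

end Field

section Laurent

variable (F : Type u) [Field F]

/-- The variable `x` of the Laurent series field `F((x))`. -/
def laurentX : LaurentSeries F := HahnSeries.single (1 : ℤ) (1 : F)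

instance laurentInvertibleTwo [Invertible (2 : F)] : Invertible (2 : LaurentSeries F) :=
  (Invertible.map (algebraMap F (LaurentSeries F)) 2).copy 2 (map_ofNat _ _).symm

end Laurent

end QForm

end

/-! The field `F(p)` is generic among the extensions over which `p` is isotropic. If `p` is
isotropic over `L`, its zeros can be parametrized rationally. So, unless `p` is the hyperbolic plane
and `F(p) = F`, `F(p)` embeds over `F` into a rational function field over `L`. Anisotropic forms
stay anisotropic under such a purely transcendental extension, so by Witt decomposition and
cancellation a form hyperbolic over `F(p)` is hyperbolic over `L` (`exists_field_functionField`,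
`IsHyperbolic.of_map`).

(i) ⇒ (ii): if `p` is isotropic over `K`, then `q` is hyperbolic over `K` and every scalar is a
similarity factor. Otherwise an element `a` of `H_K(p)` gives `p(u) = a p(v)` with `p(v) ≠ 0`. Put
`B = b(u,v)` for the symmetric bilinear form `b` of `p`, and `d = B² - p(u)p(v)`. If `d` is a
square, anisotropy makes `u` and `v` proportional and `a` is a square. If not, `p` is isotropic over
`K(√d)`, so `q` is hyperbolic there, and norms from `K(√d)` are similarity factors of `q`
(`norm_smul_equivalent_of_isHyperbolic`). The norm `B² - d = a p(v)²` then puts `a` in `G_K(q)`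
(`smul_equivalent_of_perpNeg_not_anisotropic`).

(ii) ⇒ (iii): over the function field of `p ⊥ -xp` the scalar `x` lies in `H(p)`, hence in `G(q)`,
and `q ⊥ -xq ≃ q ⊥ -q`.

(iii) ⇒ (i): over `F(p)((x))` the form `p`, hence `p ⊥ -xp`, is isotropic, so `q ⊥ -xq` is
hyperbolic there by genericity. A Springer-type descent on powers of `x` shows that `q` is
hyperbolic over `F(p)` (`IsHyperbolic.of_perpNeg_laurentX`).

When `p` represents `1`, `D(p) ⊆ H(p)`, and the same arguments with `p ⊥ ⟨-x⟩` in place of `p ⊥ -xp`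
close the cycle through (iv) and (v). -/

noncomputable section
namespace QForm

/-! ### Diagonal forms, orthogonal sums and hyperbolic forms over commutative rings. -/

section Ring

variable {R : Type*} [CommRing R]

/-- The diagonal form `⟨w i⟩`. -/
abbrev diag {ι : Type*} [Fintype ι] (w : ι → R) : QuadraticForm R (ι → R) :=
  QuadraticMap.weightedSumSquares R w

theorem diag_apply {ι : Type*} [Fintype ι] (w x : ι → R) :
    diag w x = ∑ i, w i * (x i * x i) := by
  simp [diag, QuadraticMap.weightedSumSquares_apply]

theorem diag_polar {ι : Type*} [Fintype ι] (w x y : ι → R) :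
    QuadraticMap.polar (diag w) x y = 2 * ∑ i, w i * (x i * y i) := by
  simp only [QuadraticMap.polar, diag_apply, Pi.add_apply, Finset.mul_sum,
    ← Finset.sum_sub_distrib]
  exact Finset.sum_congr rfl fun i _ => by ring

theorem diag_prod_equivalent {ι κ : Type*} [Fintype ι] [Fintype κ] (w : ι → R) (w' : κ → R) :
    ((diag w).prod (diag w')).Equivalent (diag (Sum.elim w w')) :=
  ⟨{ (LinearEquiv.sumArrowLequivProdArrow ι κ R R).symm with
      map_app' := by
        rintro ⟨x, y⟩
        simp [QuadraticMap.weightedSumSquares_apply] }⟩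

theorem diag_reindex_equivalent {ι κ : Type*} [Fintype ι] [Fintype κ] (e : ι ≃ κ) (w : κ → R) :
    (diag w).Equivalent (diag (w ∘ e)) :=
  ⟨{ LinearEquiv.funCongrLeft R R e with
      map_app' := by
        intro x
        simp only [AddHom.toFun_eq_coe, LinearMap.coe_toAddHom, LinearEquiv.coe_coe,
          LinearEquiv.funCongrLeft_apply, diag_apply, LinearMap.funLeft_apply, Function.comp_apply]
        exact e.sum_comp fun i => w i * (x i * x i) }⟩

theorem pi_diag_equivalent {ι κ : Type*} [Fintype ι] [Fintype κ] (w : κ → R) :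
    (QuadraticMap.pi fun _ : ι => diag w).Equivalent (diag fun i : ι × κ => w i.2) :=
  ⟨{ (LinearEquiv.curry R R ι κ).symm with
      map_app' := by
        intro x
        simp [Fintype.sum_prod_type, QuadraticMap.pi_apply] }⟩

theorem smul_diag {ι : Type*} [Fintype ι] (a : R) (w : ι → R) :
    a • diag w = diag (a • w) := by
  ext x
  simp [Finset.mul_sum, mul_assoc]

theorem smul_equivalent {M N : Type*} [AddCommGroup M] [Module R M] [AddCommGroup N] [Module R N]
    {Q : QuadraticForm R M} {Q' : QuadraticForm R N} (a : R) (h : Q.Equivalent Q') :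
    (a • Q).Equivalent (a • Q') := by
  obtain ⟨e⟩ := h
  exact ⟨{ e.toLinearEquiv with map_app' := fun x => congrArg (a • ·) (e.map_app x) }⟩

theorem smul_mul_self_equivalent {M : Type*} [AddCommGroup M] [Module R M]
    (Q : QuadraticForm R M) (c : Rˣ) : (((c : R) * c) • Q).Equivalent Q :=
  ⟨{ LinearEquiv.smulOfUnit c with
      map_app' := fun x => by
        exact Q.map_smul (c : R) x }⟩

theorem prod_assoc_equivalent {M₁ M₂ M₃ : Type*} [AddCommGroup M₁] [Module R M₁]
    [AddCommGroup M₂] [Module R M₂] [AddCommGroup M₃] [Module R M₃]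
    (Q₁ : QuadraticForm R M₁) (Q₂ : QuadraticForm R M₂) (Q₃ : QuadraticForm R M₃) :
    ((Q₁.prod Q₂).prod Q₃).Equivalent (Q₁.prod (Q₂.prod Q₃)) :=
  ⟨{ LinearEquiv.prodAssoc R M₁ M₂ M₃ with
      map_app' := by rintro ⟨⟨x, y⟩, z⟩; simp [add_assoc] }⟩

theorem smul_prod {M₁ M₂ : Type*} [AddCommGroup M₁] [Module R M₁]
    [AddCommGroup M₂] [Module R M₂] (a : R)
    (Q₁ : QuadraticForm R M₁) (Q₂ : QuadraticForm R M₂) :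
    a • Q₁.prod Q₂ = (a • Q₁).prod (a • Q₂) := by
  ext ⟨x, y⟩
  simp [mul_add]

theorem perpNeg_equivalent {M N : Type*} [AddCommGroup M] [Module R M] [AddCommGroup N]
    [Module R N] {Q : QuadraticForm R M} {Q' : QuadraticForm R N} (a : R) (h : Q.Equivalent Q') :
    (perpNeg a Q).Equivalent (perpNeg a Q') :=
  h.prod (smul_equivalent _ h)

theorem perpNeg_prod_equivalent {M₁ M₂ : Type*} [AddCommGroup M₁] [Module R M₁]
    [AddCommGroup M₂] [Module R M₂] (a : R)
    (Q₁ : QuadraticForm R M₁) (Q₂ : QuadraticForm R M₂) :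
    (perpNeg a (Q₁.prod Q₂)).Equivalent ((perpNeg a Q₁).prod (perpNeg a Q₂)) := by
  rw [perpNeg, smul_prod]
  exact ⟨QuadraticMap.IsometryEquiv.prodProdProdComm _ _ _ _⟩

theorem perpNeg_diag_equivalent {ι : Type*} [Fintype ι] (a : R) (w : ι → R) :
    (perpNeg a (diag w)).Equivalent (diag (Sum.elim w ((-a) • w))) := by
  rw [perpNeg, smul_diag]
  exact diag_prod_equivalent _ _

theorem anisotropic_congr {M N : Type*} [AddCommGroup M] [Module R M] [AddCommGroup N]
    [Module R N] {Q : QuadraticForm R M} {Q' : QuadraticForm R N} (h : Q.Equivalent Q') :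
    Q.Anisotropic ↔ Q'.Anisotropic := by
  obtain ⟨e⟩ := h
  constructor
  · intro hQ y hy
    have := hQ (e.symm y) (by rw [e.symm.map_app, hy])
    simpa using congrArg e this
  · intro hQ y hy
    have := hQ (e y) (by rw [e.map_app, hy])
    simpa using congrArg e.symm this

theorem isHyperbolic_congr {M N : Type*} [AddCommGroup M] [Module R M] [AddCommGroup N]
    [Module R N] {Q : QuadraticForm R M} {Q' : QuadraticForm R N} (h : Q.Equivalent Q') :
    IsHyperbolic Q ↔ IsHyperbolic Q' :=
  exists_congr fun _ => ⟨fun h' => h.symm.trans h', fun h' => h.trans h'⟩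

theorem pi_succ_equivalent {M : Type*} [AddCommGroup M] [Module R M] (Q : QuadraticForm R M)
    (m : ℕ) : (QuadraticMap.pi fun _ : Fin (m + 1) => Q).Equivalent
      (Q.prod (QuadraticMap.pi fun _ : Fin m => Q)) :=
  ⟨{ (Fin.consLinearEquiv R fun _ : Fin (m + 1) => M).symm with
      map_app' := by
        intro x
        simp [QuadraticMap.pi_apply, Fin.sum_univ_succ, Fin.tail] }⟩

theorem IsHyperbolic.hyperbolicPlane_prod {M : Type*} [AddCommGroup M] [Module R M]
    {Q : QuadraticForm R M} (h : IsHyperbolic Q) : IsHyperbolic ((hyperbolicPlane R).prod Q) := by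
  obtain ⟨m, hm⟩ := h
  exact ⟨m + 1, ((QuadraticMap.Equivalent.refl _).prod hm).trans (pi_succ_equivalent _ m).symm⟩

theorem IsHyperbolic.of_subsingleton {M : Type*} [AddCommGroup M] [Module R M] [Subsingleton M]
    (Q : QuadraticForm R M) : IsHyperbolic Q :=
  ⟨0, ⟨{ (0 : M ≃ₗ[R] (Fin 0 → Fin 2 → R)) with
      map_app' := fun x => by
        rw [Subsingleton.elim x 0]
        simp }⟩⟩

theorem IsHyperbolic.not_anisotropic [Nontrivial R] {M : Type*} [AddCommGroup M] [Module R M]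
    [Nontrivial M] {Q : QuadraticForm R M} (h : IsHyperbolic Q) : ¬ Q.Anisotropic := by
  obtain ⟨m, hm⟩ := h
  rw [anisotropic_congr hm]
  intro ha
  rcases m with _ | m
  · obtain ⟨e⟩ := hm
    exact not_subsingleton M e.toLinearEquiv.toEquiv.subsingleton
  · have := ha (fun _ _ => 1) (by
      simp [QuadraticMap.pi_apply, hyperbolicPlane, QuadraticMap.weightedSumSquares_apply])
    exact one_ne_zero (congrFun (congrFun this 0) 0)

end Ring

/-- The inverse of `2` in an algebra over a ring in which `2` is invertible. -/
abbrev invertibleTwo (R A : Type*) [CommRing R] [Invertible (2 : R)] [CommRing A] [Algebra R A] :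
    Invertible (2 : A) :=
  (Invertible.map (algebraMap R A) 2).copy 2 (map_ofNat _ _).symm

/-! ### Scalar extension in diagonal coordinates. -/

section BaseChange

variable {R : Type*} [CommRing R] [Invertible (2 : R)] (A : Type*) [CommRing A] [Algebra R A]

open TensorProduct

theorem equivalent_baseChange {M N : Type*} [AddCommGroup M] [Module R M] [AddCommGroup N]
    [Module R N] {Q : QuadraticForm R M} {Q' : QuadraticForm R N} (h : Q.Equivalent Q') :
    (Q.baseChange A).Equivalent (Q'.baseChange A) := by
  obtain ⟨e⟩ := h
  have key : (Q'.baseChange A).comp (e.toLinearEquiv.baseChange R A M N).toLinearMap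
      = Q.baseChange A := by
    refine baseChange_ext fun m => ?_
    simp [QuadraticForm.baseChange_tmul]
  exact ⟨{ e.toLinearEquiv.baseChange R A M N with
      map_app' := fun x => DFunLike.congr_fun key x }⟩

theorem diag_baseChange_equivalent {ι : Type*} [Fintype ι] (w : ι → R) :
    ((diag w).baseChange A).Equivalent (diag (algebraMap R A ∘ w)) := by
  classical
  have key : (diag (algebraMap R A ∘ w)).comp (piScalarRight R A A ι).toLinearMap
      = (diag w).baseChange A := by
    refine baseChange_ext fun m => ?_
    simp [QuadraticForm.baseChange_tmul, Algebra.smul_def]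
  exact ⟨{ piScalarRight R A A ι with
      map_app' := fun x => DFunLike.congr_fun key x }⟩

theorem baseChange_equivalent_diag {M ι : Type*} [AddCommGroup M] [Module R M] [Fintype ι]
    {Q : QuadraticForm R M} {w : ι → R} (h : Q.Equivalent (diag w)) :
    (Q.baseChange A).Equivalent (diag (algebraMap R A ∘ w)) :=
  (equivalent_baseChange A h).trans (diag_baseChange_equivalent A w)

end BaseChange

section Map

variable {R : Type*} [CommRing R] [Invertible (2 : R)] {A : Type*} [CommRing A]

/-- Working with entries of diagonal forms instead of tensor products makes scalar extension
available along any ring homomorphism, with no scalar towers to check. -/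
theorem diag_map_equivalent {ι κ : Type*} [Fintype ι] [Fintype κ] {w : ι → R} {w' : κ → R}
    (φ : R →+* A) (h : (diag w).Equivalent (diag w')) :
    (diag (φ ∘ w)).Equivalent (diag (φ ∘ w')) := by
  let := φ.toAlgebra
  exact (diag_baseChange_equivalent A w).symm.trans (baseChange_equivalent_diag A h)

theorem IsHyperbolic.diag_map {ι : Type*} [Fintype ι] {w : ι → R} (φ : R →+* A)
    (h : IsHyperbolic (diag w)) : IsHyperbolic (diag (φ ∘ w)) := by
  obtain ⟨m, hm⟩ := h
  refine ⟨m, ?_⟩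
  have := diag_map_equivalent φ (hm.trans (pi_diag_equivalent _))
  refine this.trans (QuadraticMap.Equivalent.trans ?_ (pi_diag_equivalent _).symm)
  rw [show (φ ∘ fun i : Fin m × Fin 2 => ![(1 : R), -1] i.2) =
    fun i : Fin m × Fin 2 => ![(1 : A), -1] i.2 by
      funext ⟨i, j⟩
      fin_cases j <;> simp]

end Map

open QuadraticMap

/-! ### Witt cancellation, splitting off subforms, and descent of hyperbolicity. -/

section Witt

variable {K : Type*} [Field K] {V : Type*} [AddCommGroup V] [Module K V]
  {W : Type*} [AddCommGroup W] [Module K W]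

/-- The one-dimensional form `⟨a⟩`. -/
abbrev unary (a : K) : QuadraticForm K K := a • QuadraticMap.sq

theorem map_smul_add (Q : QuadraticForm K V) (c : K) (x y : V) :
    Q (c • x + y) = c * c * Q x + Q y + c * polar Q x y := by
  rw [QuadraticMap.map_add (⇑Q), QuadraticMap.map_smul, QuadraticMap.polar_smul_left]
  simp

theorem polar_self' (Q : QuadraticForm K V) (x : V) : polar Q x x = 2 * Q x := by
  rw [QuadraticMap.polar_self]; simp

theorem inv_smul_polarBilin_self (Q : QuadraticForm K V) {r : V} (hr : Q r ≠ 0) :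
    ((Q r)⁻¹ • Q.polarBilin r) r = 2 := by
  simp [field]

theorem reflection_apply (Q : QuadraticForm K V) {r : V} (hr : Q r ≠ 0) (x : V) :
    Module.reflection (inv_smul_polarBilin_self Q hr) x = x - ((Q r)⁻¹ * polar Q r x) • r := by
  rw [Module.reflection_apply]
  simp

/-- The reflection along an anisotropic vector. -/
def reflection (Q : QuadraticForm K V) (r : V) (hr : Q r ≠ 0) : Q.IsometryEquiv Q :=
  { Module.reflection (inv_smul_polarBilin_self Q hr) with
    map_app' := fun x => by
      change Q (Module.reflection (inv_smul_polarBilin_self Q hr) x) = Q x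
      rw [reflection_apply Q hr, sub_eq_add_neg, ← neg_smul, add_comm, map_smul_add]
      field_simp
      ring }

/-- The isometry `-1`. -/
def negIsometry (Q : QuadraticForm K V) : Q.IsometryEquiv Q :=
  { LinearEquiv.neg K with map_app' := fun x => by simp }

/-- Since `Q (u - v) + Q (u + v) = 4 * Q u ≠ 0`, one of `u - v`, `u + v` is anisotropic. The
reflection along the first sends `u` to `v`; the reflection along the second sends `u` to `-v`. -/
theorem exists_isometry_apply_eq (h2 : (2 : K) ≠ 0) (Q : QuadraticForm K V) {u v : V}
    (hu : Q u ≠ 0) (huv : Q u = Q v) : ∃ e : Q.IsometryEquiv Q, e u = v := by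
  have e1 : Q (u - v) = 2 * Q u - polar Q u v := by
    have := map_smul_add Q (-1) v u
    rw [show (-1 : K) • v + u = u - v by rw [neg_one_smul]; abel, polar_comm] at this
    rw [this, huv]; ring
  have e2 : Q (u + v) = 2 * Q u + polar Q u v := by
    have := map_smul_add Q 1 u v
    rw [one_smul] at this
    rw [this, huv]; ring
  by_cases h : Q (u - v) = 0
  · have h' : Q (u + v) ≠ 0 := by
      intro h'
      apply mul_ne_zero (mul_ne_zero h2 h2) hu
      linear_combination h' + h - e1 - e2
    refine ⟨(reflection Q (u + v) h').trans (negIsometry Q), ?_⟩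
    have : polar Q (u + v) u = Q (u + v) := by
      rw [polar_add_left, polar_self', polar_comm Q v u, e2]
    change -(Module.reflection (inv_smul_polarBilin_self Q h') u) = v
    rw [reflection_apply Q h', this, inv_mul_cancel₀ h']
    simp
  · refine ⟨reflection Q (u - v) h, ?_⟩
    have : polar Q (u - v) u = Q (u - v) := by
      rw [polar_sub_left, polar_self', polar_comm Q v u, e1]
    change Module.reflection (inv_smul_polarBilin_self Q h) u = v
    rw [reflection_apply Q h, this, inv_mul_cancel₀ h]
    simp

theorem polar_unary_prod (a : K) (Q : QuadraticForm K V) (x y : K × V) :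
    polar ((unary a).prod Q) x y = 2 * a * (x.1 * y.1) + polar Q x.2 y.2 := by
  simp only [polar, QuadraticMap.prod_apply, smul_apply, QuadraticMap.sq_apply,
    Prod.fst_add, Prod.snd_add, smul_eq_mul]
  ring

theorem polar_isometryEquiv {Q : QuadraticForm K V} {Q' : QuadraticForm K W}
    (e : Q.IsometryEquiv Q') (x y : V) : polar Q' (e x) (e y) = polar Q x y := by
  have : e (x + y) = e x + e y := map_add e.toLinearEquiv x y
  simp only [polar, ← this, e.map_app]

/-- **Witt cancellation** of a one-dimensional form. -/
theorem unary_cancel (h2 : (2 : K) ≠ 0) {a : K} (ha : a ≠ 0) {Q : QuadraticForm K V}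
    {Q' : QuadraticForm K W} (h : ((unary a).prod Q).Equivalent ((unary a).prod Q')) :
    Q.Equivalent Q' := by
  obtain ⟨e⟩ := h
  obtain ⟨s, hs⟩ := exists_isometry_apply_eq h2 ((unary a).prod Q') (u := e (1, 0))
    (v := (1, 0)) (by rw [e.map_app]; simpa using ha) (by rw [e.map_app]; simp)
  set f := e.trans s with hf
  have hf1 : f (1, 0) = (1, 0) := hs
  have hf2 : f.symm (1, 0) = (1, 0) := by simpa using (congrArg f.symm hf1).symm
  -- The isometry `f` fixes `(1, 0)`, so it preserves the pairing with that vector, which is the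
  -- first coordinate up to the unit `2 * a`. It therefore restricts to the orthogonal complements.
  have aux (x : K × V) : (f x).1 = x.1 := by
    have := polar_isometryEquiv f (1, 0) x
    rw [hf1, polar_unary_prod, polar_unary_prod] at this
    simpa [h2, ha] using this
  have aux' (x : K × W) : (f.symm x).1 = x.1 := by
    have := aux (f.symm x)
    rwa [f.apply_symm_apply, eq_comm] at this
  have g (x : V) : f (0, x) = (0, (f (0, x)).2) := Prod.ext (aux _) rfl
  have g' (x : W) : f.symm (0, x) = (0, (f.symm (0, x)).2) := Prod.ext (aux' _) rfl
  let t : V →ₗ[K] W := LinearMap.snd K K W ∘ₗ f.toLinearEquiv.toLinearMap ∘ₗ LinearMap.inr K K V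
  let t' : W →ₗ[K] V :=
    LinearMap.snd K K V ∘ₗ f.symm.toLinearEquiv.toLinearMap ∘ₗ LinearMap.inr K K W
  have h1 (x : W) : t (t' x) = x := by
    change (f (0, (f.symm (0, x)).2)).2 = x
    rw [← g', f.apply_symm_apply]
  have h1' (x : V) : t' (t x) = x := by
    change (f.symm (0, (f (0, x)).2)).2 = x
    rw [← g, f.symm_apply_apply]
  refine ⟨{ t with
    invFun := t'
    left_inv := h1'
    right_inv := h1
    map_app' := fun x => ?_ }⟩
  change Q' (f (0, x)).2 = Q x
  have := f.map_app (0, x)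
  rw [g] at this
  simpa using this

theorem diag_pair_equivalent (a b : K) :
    (diag ![a, b]).Equivalent ((unary a).prod (unary b)) :=
  ⟨{ LinearEquiv.finTwoArrow K K with
      map_app' := fun x => by simp [weightedSumSquares_apply] }⟩

theorem hyperbolicPlane_prod_equivalent (Q : QuadraticForm K V) :
    ((hyperbolicPlane K).prod Q).Equivalent ((unary (1 : K)).prod ((unary (-1 : K)).prod Q)) :=
  ((diag_pair_equivalent 1 (-1)).prod (.refl Q)).trans (prod_assoc_equivalent _ _ _)

theorem hyperbolicPlane_cancel (h2 : (2 : K) ≠ 0) {Q : QuadraticForm K V}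
    {Q' : QuadraticForm K W}
    (h : ((hyperbolicPlane K).prod Q).Equivalent ((hyperbolicPlane K).prod Q')) :
    Q.Equivalent Q' :=
  unary_cancel h2 (neg_ne_zero.2 one_ne_zero) <| unary_cancel h2 one_ne_zero <|
    ((hyperbolicPlane_prod_equivalent Q).symm.trans h).trans (hyperbolicPlane_prod_equivalent Q')

theorem IsHyperbolic.of_hyperbolicPlane_prod (h2 : (2 : K) ≠ 0) {Q : QuadraticForm K V}
    (h : IsHyperbolic ((hyperbolicPlane K).prod Q)) : IsHyperbolic Q := by
  obtain ⟨m, hm⟩ := h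
  rcases m with _ | m
  · obtain ⟨e⟩ := hm
    have := congrArg Prod.fst (e.toLinearEquiv.toEquiv.subsingleton.elim (fun _ => 1, 0) 0)
    exact absurd (congrFun this 0) (by simp)
  · exact ⟨m, hyperbolicPlane_cancel h2 (hm.trans (pi_succ_equivalent _ m))⟩

/-- An anisotropic vector splits off. -/
theorem equivalent_unary_prod (h2 : (2 : K) ≠ 0) (Q : QuadraticForm K V) {x : V} (hx : Q x ≠ 0) :
    Q.Equivalent ((unary (Q x)).prod (Q.restrict (LinearMap.ker (Q.polarBilin x)))) := by
  set W := LinearMap.ker (Q.polarBilin x)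
  have hW (y : W) : polar Q x y = 0 := y.2
  let f : (K × W) →ₗ[K] V := (LinearMap.toSpanSingleton K V x).coprod W.subtype
  have hf (c : K) (y : W) : f (c, y) = c • x + y := by simp [f]
  have hfp (c : K) (y : W) : polar Q x (f (c, y)) = c * (2 * Q x) := by
    rw [hf, polar_add_right, polar_smul_right, polar_self', hW]; simp
  have hbij : Function.Bijective f := by
    constructor
    · rw [← LinearMap.ker_eq_bot, LinearMap.ker_eq_bot']
      rintro ⟨c, y⟩ h
      have hc : c = 0 := by
        have := hfp c y
        rw [h] at this
        simpa [h2, hx] using this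
      subst hc
      rw [hf] at h
      ext <;> simp_all
    · intro v
      have hm : v - (polar Q x v / (2 * Q x)) • x ∈ W := by
        change polar Q x _ = 0
        rw [polar_sub_right, polar_smul_right, polar_self']
        simp only [smul_eq_mul]
        field_simp
        ring
      exact ⟨(polar Q x v / (2 * Q x), ⟨_, hm⟩), by rw [hf]; simp⟩
  refine QuadraticMap.Equivalent.symm ⟨{ LinearEquiv.ofBijective f hbij with
    map_app' := ?_ }⟩
  rintro ⟨c, y⟩
  change Q (f (c, y)) = _
  rw [hf, map_smul_add, hW]
  simp [mul_comm]

theorem finrank_eq_of_equivalent {Q : QuadraticForm K V} {Q' : QuadraticForm K W}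
    (h : Q.Equivalent Q') : Module.finrank K V = Module.finrank K W := by
  obtain ⟨e⟩ := h
  exact e.toLinearEquiv.finrank_eq

theorem hyperbolicPlane_not_anisotropic : ¬ (hyperbolicPlane K).Anisotropic := by
  intro h
  have := h (fun _ => 1) (by simp [hyperbolicPlane, weightedSumSquares_apply])
  exact one_ne_zero (congrFun this 0)

variable [Invertible (2 : K)]

theorem nondegenerate_iff (Q : QuadraticForm K V) :
    Q.Nondegenerate ↔ ∀ x, (∀ y, polar Q x y = 0) → x = 0 := by
  rw [nondegenerate_iff_radical_eq_bot, radical_eq_ker_polarBilin, LinearMap.ker_eq_bot']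
  simp [LinearMap.ext_iff]

theorem nondegenerate_congr {Q : QuadraticForm K V} {Q' : QuadraticForm K W}
    (h : Q.Equivalent Q') (hQ : Q.Nondegenerate) : Q'.Nondegenerate := by
  obtain ⟨e⟩ := h
  rw [nondegenerate_iff] at hQ ⊢
  intro x hx
  have := hQ (e.symm x) fun y => by
    rw [← polar_isometryEquiv e, e.apply_symm_apply, hx]
  simpa using congrArg e this

theorem nondegenerate_of_prod {Q : QuadraticForm K V} {Q' : QuadraticForm K W}
    (h : (Q.prod Q').Nondegenerate) : Q'.Nondegenerate := by
  rw [nondegenerate_iff] at h ⊢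
  intro x hx
  have := h (0, x) fun y => by simp [polar_prod, hx]
  simpa using this

theorem nondegenerate_smul {Q : QuadraticForm K V} (hQ : Q.Nondegenerate) {a : K} (ha : a ≠ 0) :
    (a • Q).Nondegenerate := by
  rw [nondegenerate_iff] at hQ ⊢
  intro x hx
  refine hQ x fun y => ?_
  have := hx y
  rw [FunLike.coe_smul, polar_smul] at this
  simpa [ha] using this

theorem nondegenerate_prod {Q : QuadraticForm K V} {Q' : QuadraticForm K W}
    (hQ : Q.Nondegenerate) (hQ' : Q'.Nondegenerate) : (Q.prod Q').Nondegenerate := by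
  rw [nondegenerate_iff] at hQ hQ' ⊢
  rintro ⟨x, y⟩ h
  have h1 := hQ x fun z => by simpa [polar_prod] using h (z, 0)
  have h2 := hQ' y fun z => by simpa [polar_prod] using h (0, z)
  rw [h1, h2]; rfl

theorem nondegenerate_diag_iff {ι : Type*} [Fintype ι] (w : ι → K) :
    (diag w).Nondegenerate ↔ ∀ i, w i ≠ 0 := by
  classical
  have h2 : (2 : K) ≠ 0 := Invertible.ne_zero 2
  rw [nondegenerate_iff]
  simp only [diag_polar, mul_eq_zero, h2, false_or]
  constructor
  · intro h i hi
    have := h (Pi.single i 1) fun y => Finset.sum_eq_zero fun j _ => by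
      by_cases hj : j = i
      · subst hj; simp [hi]
      · simp [hj]
    exact one_ne_zero (α := K) (by simpa using congrFun this i)
  · intro h x hx
    funext i
    have := hx (Pi.single i 1)
    rw [Finset.sum_eq_single i (by intro j _ hj; simp [hj]) (by simp)] at this
    simpa [h i] using this

theorem exists_diag_equivalent [FiniteDimensional K V] {Q : QuadraticForm K V}
    (hQ : Q.Nondegenerate) :
    ∃ w : Fin (Module.finrank K V) → K, (∀ i, w i ≠ 0) ∧ Q.Equivalent (diag w) := by
  obtain ⟨w, hw⟩ := Q.equivalent_weightedSumSquares
  exact ⟨w, (nondegenerate_diag_iff w).1 (nondegenerate_congr hw hQ), hw⟩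

/-- Two orthogonal anisotropic vectors split off. -/
theorem equivalent_unary_prod_unary_prod_diag [FiniteDimensional K V] {Q : QuadraticForm K V}
    (hQ : Q.Nondegenerate) {x y : V} (hx : Q x ≠ 0) (hy : Q y ≠ 0) (hxy : polar Q x y = 0) :
    ∃ (n : ℕ) (w : Fin n → K), (∀ i, w i ≠ 0) ∧ Module.finrank K V = n + 2 ∧
      Q.Equivalent ((unary (Q x)).prod ((unary (Q y)).prod (diag w))) := by
  have h2 : (2 : K) ≠ 0 := Invertible.ne_zero 2
  have e1 := equivalent_unary_prod h2 Q hx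
  set Q1 := Q.restrict (LinearMap.ker (Q.polarBilin x))
  have hQ1 : Q1.Nondegenerate := nondegenerate_of_prod (nondegenerate_congr e1 hQ)
  have e2 := equivalent_unary_prod h2 Q1 (x := ⟨y, hxy⟩) hy
  set Q2 := Q1.restrict _
  have hQ2 : Q2.Nondegenerate := nondegenerate_of_prod (nondegenerate_congr e2 hQ1)
  obtain ⟨w, hw, e3⟩ := exists_diag_equivalent hQ2
  refine ⟨_, w, hw, ?_, e1.trans ((QuadraticMap.Equivalent.refl _).prod
    (e2.trans ((QuadraticMap.Equivalent.refl _).prod e3)))⟩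
  rw [finrank_eq_of_equivalent e1, Module.finrank_prod, finrank_eq_of_equivalent e2,
    Module.finrank_prod, Module.finrank_self]
  ring

/-- An isotropic nondegenerate form represents every scalar, on an orthogonal pair of vectors
with opposite values. -/
theorem exists_polar_eq_zero_of_not_anisotropic {Q : QuadraticForm K V} (hQ : Q.Nondegenerate)
    (h : ¬ Q.Anisotropic) (a : K) : ∃ x y, Q x = a ∧ Q y = -a ∧ polar Q x y = 0 := by
  have h2 : (2 : K) ≠ 0 := Invertible.ne_zero 2
  simp only [QuadraticMap.Anisotropic, not_forall] at h
  obtain ⟨u, hu, hu0⟩ := h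
  obtain ⟨v, hv⟩ : ∃ v, polar Q u v ≠ 0 := by
    by_contra! hcon
    exact hu0 ((nondegenerate_iff Q).1 hQ u hcon)
  set b := polar Q u v with hb
  -- As `Q u = 0`, one has `Q (c • u + v) = Q v + c * b`; the two coefficients solve this for the
  -- values `a` and `-a`. Their sum is `-2 * Q v / b`, which makes the two vectors orthogonal.
  refine ⟨((a - Q v) / b) • u + v, ((-a - Q v) / b) • u + v, ?_, ?_, ?_⟩
  · rw [map_smul_add, hu, ← hb]; field_simp; ring
  · rw [map_smul_add, hu, ← hb]; field_simp; ring
  · simp only [polar_add_left, polar_add_right, polar_smul_left, polar_smul_right, polar_self', hu,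
      polar_comm Q v u, ← hb, smul_eq_mul]
    field_simp; ring

theorem equivalent_hyperbolicPlane_prod_diag [FiniteDimensional K V] {Q : QuadraticForm K V}
    (hQ : Q.Nondegenerate) (h : ¬ Q.Anisotropic) :
    ∃ (n : ℕ) (w : Fin n → K), (∀ i, w i ≠ 0) ∧ Module.finrank K V = n + 2 ∧
      Q.Equivalent ((hyperbolicPlane K).prod (diag w)) := by
  obtain ⟨x, y, hx, hy, hxy⟩ := exists_polar_eq_zero_of_not_anisotropic hQ h 1
  obtain ⟨n, w, hw, hn, e⟩ := equivalent_unary_prod_unary_prod_diag hQ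
    (by rw [hx]; exact one_ne_zero) (by rw [hy]; exact neg_ne_zero.2 one_ne_zero) hxy
  rw [hx, hy] at e
  exact ⟨n, w, hw, hn, e.trans (hyperbolicPlane_prod_equivalent _).symm⟩

theorem equivalent_hyperbolicPlane [FiniteDimensional K V] {Q : QuadraticForm K V}
    (hQ : Q.Nondegenerate) (h : ¬ Q.Anisotropic) (hd : Module.finrank K V = 2) :
    Q.Equivalent (hyperbolicPlane K) := by
  obtain ⟨n, w, -, hn, e⟩ := equivalent_hyperbolicPlane_prod_diag hQ h
  obtain rfl : n = 0 := by omega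
  refine e.trans ⟨{ LinearEquiv.prodUnique (R := K) with map_app' := fun x => ?_ }⟩
  simp [LinearEquiv.prodUnique]

theorem nondegenerate_hyperbolicPlane : (hyperbolicPlane K).Nondegenerate :=
  (nondegenerate_diag_iff _).2 fun i => by fin_cases i <;> simp

/-- A class of diagonal forms that consists of isotropic forms and is closed under splitting off
hyperbolic planes consists of hyperbolic forms. -/
theorem isHyperbolic_of_descent (T : ∀ n : ℕ, (Fin n → K) → Prop)
    (hiso : ∀ (n : ℕ) (w : Fin (n + 1) → K), (∀ i, w i ≠ 0) → T (n + 1) w →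
      ¬ (diag w).Anisotropic)
    (hsplit : ∀ (m n : ℕ) (w : Fin m → K) (w' : Fin n → K), T m w →
      (diag w).Equivalent ((hyperbolicPlane K).prod (diag w')) → T n w') :
    ∀ (n : ℕ) (w : Fin n → K), (∀ i, w i ≠ 0) → T n w → IsHyperbolic (diag w) := by
  intro n
  induction n using Nat.strong_induction_on with
  | _ n ih =>
    intro w hw hT
    rcases n with _ | n
    · exact IsHyperbolic.of_subsingleton _
    · obtain ⟨k, w', hw', hk, e⟩ := equivalent_hyperbolicPlane_prod_diag
        ((nondegenerate_diag_iff w).2 hw) (hiso n w hw hT)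
      rw [Module.finrank_fin_fun] at hk
      exact (isHyperbolic_congr e).2
        (ih k (by omega) w' hw' (hsplit _ _ _ _ hT e)).hyperbolicPlane_prod

theorem hyperbolicPlane_prod_diag_map {L : Type*} [CommRing L] (φ : K →+* L) {ι κ : Type*}
    [Fintype ι] [Fintype κ] {w : ι → K} {w' : κ → K}
    (h : (diag w).Equivalent ((hyperbolicPlane K).prod (diag w'))) :
    (diag (φ ∘ w)).Equivalent ((hyperbolicPlane L).prod (diag (φ ∘ w'))) := by
  have := diag_map_equivalent φ (h.trans (diag_prod_equivalent ![(1 : K), -1] w'))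
  rw [Sum.comp_elim] at this
  refine (this.trans (diag_prod_equivalent _ _).symm).trans ?_
  rw [show φ ∘ ![(1 : K), -1] = ![(1 : L), -1] by funext j; fin_cases j <;> simp]
  exact .refl _

/-- A form of positive dimension that becomes hyperbolic becomes isotropic, so it was isotropic
already. A hyperbolic plane splits off over `K`, is cancelled over `L`, and the dimension drops. -/
theorem IsHyperbolic.of_map {L : Type*} [Field L] (φ : K →+* L)
    (hφ : ∀ (n : ℕ) (w : Fin n → K), (∀ i, w i ≠ 0) → (diag w).Anisotropic →
      (diag (φ ∘ w)).Anisotropic) {n : ℕ} {w : Fin n → K} (hw : ∀ i, w i ≠ 0)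
    (h : IsHyperbolic (diag (φ ∘ w))) : IsHyperbolic (diag w) := by
  have h2 : (2 : L) ≠ 0 := by
    simpa only [map_ofNat, map_zero] using φ.injective.ne (Invertible.ne_zero (2 : K))
  refine isHyperbolic_of_descent (fun _ w => IsHyperbolic (diag (φ ∘ w))) ?_ ?_ n w hw h
  · intro n w hw hT hw'
    exact hT.not_anisotropic (hφ _ w hw hw')
  · intro m n w w' hT e
    exact ((isHyperbolic_congr (hyperbolicPlane_prod_diag_map φ e)).1 hT).of_hyperbolicPlane_prod h2

end Witt

/-! ### Anisotropy over polynomial rings, fraction fields, power series and Laurent series. -/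

section Lifting

variable {ι : Type*} [Fintype ι]

theorem map_diag {R S : Type*} [CommRing R] [CommRing S] (φ : R →+* S) (w x : ι → R) :
    diag (φ ∘ w) (φ ∘ x) = φ (diag w x) := by
  simp

theorem anisotropic_of_injective {R S : Type*} [CommRing R] [CommRing S] {φ : R →+* S}
    (hφ : Function.Injective φ) {w : ι → R} (h : (diag (φ ∘ w)).Anisotropic) :
    (diag w).Anisotropic := by
  intro x hx
  have := h (φ ∘ x) (by rw [map_diag, hx, map_zero])
  funext i
  exact hφ (by simpa using congrFun this i)

theorem not_anisotropic_of_injective {R S : Type*} [CommRing R] [CommRing S] {φ : R →+* S}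
    (hφ : Function.Injective φ) {w : ι → R} (h : ¬ (diag w).Anisotropic) :
    ¬ (diag (φ ∘ w)).Anisotropic := fun h' => h (anisotropic_of_injective hφ h')

theorem diag_smul {R : Type*} [CommRing R] (w x : ι → R) (c : R) :
    diag w (c • x) = c * c * diag w x := by
  rw [QuadraticMap.map_smul, smul_eq_mul]

theorem exists_smul_eq_algebraMap_comp (R : Type*) {K : Type*} [CommRing R] [IsDomain R] [Field K]
    [Algebra R K] [IsFractionRing R K] (x : ι → K) :
    ∃ (c : R) (y : ι → R), c ≠ 0 ∧ algebraMap R K c • x = algebraMap R K ∘ y := by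
  obtain ⟨b, hb⟩ := IsLocalization.exist_integer_multiples_of_finite (nonZeroDivisors R) x
  choose y hy using hb
  refine ⟨b, y, nonZeroDivisors.coe_ne_zero b, funext fun i => ?_⟩
  rw [Function.comp_apply, hy i]
  simp [Algebra.smul_def]

theorem anisotropic_fractionRing {R K : Type*} [CommRing R] [IsDomain R] [Field K] [Algebra R K]
    [IsFractionRing R K] {w : ι → R} (h : (diag w).Anisotropic) :
    (diag (algebraMap R K ∘ w)).Anisotropic := by
  intro x hx
  obtain ⟨c, y, hc, hy⟩ := exists_smul_eq_algebraMap_comp R x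
  have hinj := IsFractionRing.injective R K
  have hc' : algebraMap R K c ≠ 0 := (map_ne_zero_iff _ hinj).2 hc
  have h1 : diag w y = 0 := hinj (by rw [← map_diag, ← hy, diag_smul, hx]; simp)
  have h2 := h y h1
  rw [h2] at hy
  have : algebraMap R K c • x = 0 := by rw [hy]; funext i; simp
  exact (smul_eq_zero.1 this).resolve_left hc'

section PowerSeries

open PowerSeries

variable {R : Type*} [CommRing R]

theorem exists_eq_X_smul {w : ι → R} (h : (diag w).Anisotropic) {U : ι → R⟦X⟧} {S : R⟦X⟧}
    (hU : diag (C ∘ w) U = X * S) : ∃ U' : ι → R⟦X⟧, U = (X : R⟦X⟧) • U' := by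
  have h0 : diag w (constantCoeff ∘ U) = 0 := by
    have := congrArg constantCoeff hU
    rw [← map_diag] at this
    rw [← Function.comp_assoc] at this
    simpa [Function.comp_def] using this
  have h1 := h _ h0
  have h2 (i : ι) : (X : R⟦X⟧) ∣ U i := X_dvd_iff.2 (congrFun h1 i)
  choose U' hU' using h2
  exact ⟨U', funext hU'⟩

variable [IsDomain R]

/-- Infinite descent. The constant terms of `U` form a zero of an anisotropic form, so `U = X U'`.
Cancelling `X` leaves `diag V = X * diag U'`, so `V = X V'` likewise, and `(U', V')` satisfies the
original equation. -/
theorem X_pow_dvd_of_diag_eq_X_mul_diag {w : ι → R} (h : (diag w).Anisotropic) (n : ℕ) :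
    ∀ U V : ι → R⟦X⟧, diag (C ∘ w) U = X * diag (C ∘ w) V →
      ∀ i, (X : R⟦X⟧) ^ n ∣ U i ∧ (X : R⟦X⟧) ^ n ∣ V i := by
  induction n with
  | zero => simp
  | succ n ih =>
    intro U V hUV
    obtain ⟨U', rfl⟩ := exists_eq_X_smul h hUV
    rw [diag_smul, mul_assoc] at hUV
    have hV := (mul_left_cancel₀ X_ne_zero hUV).symm
    obtain ⟨V', rfl⟩ := exists_eq_X_smul h hV
    rw [diag_smul, mul_assoc] at hV
    intro i
    obtain ⟨h1, h2⟩ := ih U' V' (mul_left_cancel₀ X_ne_zero hV).symm i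
    rw [pow_succ']
    exact ⟨mul_dvd_mul_left _ h1, mul_dvd_mul_left _ h2⟩

theorem eq_zero_of_diag_eq_X_mul_diag {w : ι → R} (h : (diag w).Anisotropic) {U V : ι → R⟦X⟧}
    (hUV : diag (C ∘ w) U = X * diag (C ∘ w) V) : U = 0 ∧ V = 0 := by
  have key (f : R⟦X⟧) (hf : ∀ n : ℕ, (X : R⟦X⟧) ^ n ∣ f) : f = 0 := by
    ext n
    exact X_pow_dvd_iff.1 (hf (n + 1)) n (Nat.lt_succ_self n)
  exact ⟨funext fun i => key _ fun n => (X_pow_dvd_of_diag_eq_X_mul_diag h n U V hUV i).1,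
    funext fun i => key _ fun n => (X_pow_dvd_of_diag_eq_X_mul_diag h n U V hUV i).2⟩

theorem anisotropic_powerSeries {w : ι → R} (h : (diag w).Anisotropic) :
    (diag (C (R := R) ∘ w)).Anisotropic := fun U hU =>
  (eq_zero_of_diag_eq_X_mul_diag h (U := U) (V := 0) (by simp [hU])).1

theorem anisotropic_polynomial {w : ι → R} (h : (diag w).Anisotropic) :
    (diag (Polynomial.C (R := R) ∘ w)).Anisotropic := by
  refine anisotropic_of_injective (φ := Polynomial.coeToPowerSeries.ringHom)
    (Polynomial.coe_injective R) ?_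
  convert anisotropic_powerSeries h using 2
  funext i
  simp

end PowerSeries

theorem anisotropic_mvPolynomial {K : Type*} [Field K] {w : ι → K} (h : (diag w).Anisotropic)
    (n : ℕ) : (diag (MvPolynomial.C (σ := Fin n) ∘ w)).Anisotropic := by
  induction n with
  | zero =>
    refine anisotropic_of_injective
      (φ := (MvPolynomial.isEmptyRingEquiv K (Fin 0) : MvPolynomial (Fin 0) K →+* K))
      (RingEquiv.injective _) ?_
    convert h using 2
    funext i
    exact (MvPolynomial.isEmptyRingEquiv K (Fin 0)).apply_symm_apply (w i)
  | succ n ih =>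
    refine anisotropic_of_injective (φ := (MvPolynomial.finSuccEquiv K n :
      MvPolynomial (Fin (n + 1)) K →+* Polynomial (MvPolynomial (Fin n) K)))
      (AlgEquiv.injective _) ?_
    convert anisotropic_polynomial ih using 2
    funext i
    simp [MvPolynomial.finSuccEquiv_apply]

section Laurent

open LaurentSeries

variable {K : Type*} [Field K]

theorem algebraMap_powerSeries_X : algebraMap (PowerSeries K) (LaurentSeries K) PowerSeries.X =
    laurentX K := by
  simp [laurentX]

theorem algebraMap_powerSeries_C (a : K) :
    algebraMap (PowerSeries K) (LaurentSeries K) (PowerSeries.C a) =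
      algebraMap K (LaurentSeries K) a := by
  rw [HahnSeries.algebraMap_apply', ← PowerSeries.algebraMap_eq]
  rfl

theorem laurentX_ne_zero : laurentX K ≠ 0 := by
  simp [laurentX]

/-- The case of Springer's theorem needed here: after clearing denominators, a zero is a power
series solution of `w(U) = x w(V)`, which the descent on powers of `x` excludes. -/
theorem anisotropic_perpNeg_laurentX {w : ι → K} (h : (diag w).Anisotropic) :
    (perpNeg (laurentX K) (diag (algebraMap K (LaurentSeries K) ∘ w))).Anisotropic := by
  rintro ⟨U, V⟩ hUV
  have hUV' : diag (algebraMap K (LaurentSeries K) ∘ w) U =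
      laurentX K * diag (algebraMap K (LaurentSeries K) ∘ w) V := by
    simp only [perpNeg, QuadraticMap.prod_apply, smul_apply, smul_eq_mul] at hUV
    linear_combination hUV
  obtain ⟨c, y, hc, hy⟩ := exists_smul_eq_algebraMap_comp (PowerSeries K) (Sum.elim U V)
  have hinj := IsFractionRing.injective (PowerSeries K) (LaurentSeries K)
  have hc' : algebraMap (PowerSeries K) (LaurentSeries K) c ≠ 0 := (map_ne_zero_iff _ hinj).2 hc
  have hU : algebraMap _ (LaurentSeries K) c • U = algebraMap _ _ ∘ (y ∘ Sum.inl) :=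
    funext fun i => congrFun hy (Sum.inl i)
  have hV : algebraMap _ (LaurentSeries K) c • V = algebraMap _ _ ∘ (y ∘ Sum.inr) :=
    funext fun i => congrFun hy (Sum.inr i)
  have hw : algebraMap K (LaurentSeries K) ∘ w =
      algebraMap (PowerSeries K) (LaurentSeries K) ∘ (PowerSeries.C ∘ w) :=
    funext fun i => (algebraMap_powerSeries_C (w i)).symm
  obtain ⟨h1, h2⟩ := eq_zero_of_diag_eq_X_mul_diag h (U := y ∘ Sum.inl) (V := y ∘ Sum.inr) (hinj (by
    rw [map_mul, ← map_diag, ← map_diag, algebraMap_powerSeries_X, ← hU, ← hV, ← hw, diag_smul,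
      diag_smul, hUV']
    ring))
  rw [h1] at hU
  rw [h2] at hV
  have e (x : ι → LaurentSeries K) (hx : algebraMap _ (LaurentSeries K) c • x =
      algebraMap (PowerSeries K) (LaurentSeries K) ∘ (0 : ι → PowerSeries K)) : x = 0 := by
    refine (smul_eq_zero.1 (hx.trans ?_)).resolve_left hc'
    funext i; simp
  rw [e U hU, e V hV]; rfl

/-- If `q ⊥ -xq` is hyperbolic over `K((x))` for a form `q` over `K`, then `q` is hyperbolic. -/
theorem IsHyperbolic.of_perpNeg_laurentX [Invertible (2 : K)] {n : ℕ} {w : Fin n → K}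
    (hw : ∀ i, w i ≠ 0)
    (h : IsHyperbolic (perpNeg (laurentX K) (diag (algebraMap K (LaurentSeries K) ∘ w)))) :
    IsHyperbolic (diag w) := by
  have h2 : (2 : LaurentSeries K) ≠ 0 := Invertible.ne_zero 2
  refine isHyperbolic_of_descent (fun _ w =>
    IsHyperbolic (perpNeg (laurentX K) (diag (algebraMap K (LaurentSeries K) ∘ w)))) ?_ ?_ n w hw h
  · intro n w hw hT hw'
    exact hT.not_anisotropic (anisotropic_perpNeg_laurentX hw')
  · intro m n w w' hT e
    have e1 := (perpNeg_equivalent (laurentX K) (hyperbolicPlane_prod_diag_map (algebraMap K (LaurentSeries K)) e)).trans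
      (perpNeg_prod_equivalent _ _ _)
    -- A scaled hyperbolic plane is still an isotropic binary form, hence a hyperbolic plane. Each
    -- plane split from `w` thus contributes two planes to cancel.
    have e2 : (perpNeg (laurentX K) (hyperbolicPlane (LaurentSeries K))).Equivalent
        ((hyperbolicPlane _).prod (hyperbolicPlane _)) := by
      refine (QuadraticMap.Equivalent.refl _).prod (equivalent_hyperbolicPlane
        (nondegenerate_smul nondegenerate_hyperbolicPlane (neg_ne_zero.2 laurentX_ne_zero)) ?_
        (by simp))
      intro ha
      refine hyperbolicPlane_not_anisotropic (K := LaurentSeries K) fun x hx => ha x ?_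
      simp [hx]
    exact (((isHyperbolic_congr ((e1.trans (e2.prod (.refl _))).trans
      (prod_assoc_equivalent _ _ _))).1 hT).of_hyperbolicPlane_prod h2).of_hyperbolicPlane_prod h2

end Laurent

end Lifting

/-! ### Norms from a quadratic extension as similarity factors. -/

section QuadraticExtension

variable {K : Type*} [Field K]

/-- Values of the norm form `⟨1, -d⟩` are similarity factors of its scalar multiples. -/
theorem norm_smul_equivalent {c d x y : K} (hN : x * x - d * (y * y) ≠ 0) :
    ((x * x - d * (y * y)) • (unary (-d * c)).prod (unary c)).Equivalent
      ((unary (-d * c)).prod (unary c)) := by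
  set N := x * x - d * (y * y) with hNdef
  -- Multiplication by `x + y√d` on `z.2 + z.1√d`; the form is `c` times the norm of that element,
  -- so it is scaled by `N`.
  refine ⟨{ toFun := fun z => (x * z.1 + y * z.2, x * z.2 + d * y * z.1)
            invFun := fun z => (N⁻¹ * (x * z.1 - y * z.2), N⁻¹ * (x * z.2 - d * y * z.1))
            map_add' := fun z z' => by ext <;> simp <;> ring
            map_smul' := fun a z => by ext <;> simp <;> ring
            left_inv := fun z => by ext <;> simp <;> field_simp <;> simp only [hNdef] <;> ring
            right_inv := fun z => by ext <;> simp <;> field_simp <;> simp only [hNdef] <;> ring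
            map_app' := fun z => by simp [hNdef]; ring }⟩

variable [Invertible (2 : K)]

theorem smul_hyperbolicPlane_equivalent {a : K} (ha : a ≠ 0) :
    (a • hyperbolicPlane K).Equivalent (hyperbolicPlane K) := by
  refine equivalent_hyperbolicPlane (nondegenerate_smul nondegenerate_hyperbolicPlane ha) ?_
    (by simp)
  intro h
  refine hyperbolicPlane_not_anisotropic (K := K) fun x hx => h x ?_
  simp [hx]

theorem IsHyperbolic.smul_equivalent {V : Type*} [AddCommGroup V] [Module K V]
    {Q : QuadraticForm K V} (h : IsHyperbolic Q) {a : K} (ha : a ≠ 0) :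
    (a • Q).Equivalent Q := by
  obtain ⟨m, hm⟩ := h
  refine ((QForm.smul_equivalent a hm).trans ?_).trans hm.symm
  have : a • (pi fun _ : Fin m => hyperbolicPlane K) = pi fun _ : Fin m => a • hyperbolicPlane K := by
    ext x
    simp [pi_apply, Finset.mul_sum]
  rw [this]
  exact Equivalent.pi fun _ => smul_hyperbolicPlane_equivalent ha

/-- If a form over `K` becomes hyperbolic over `K(√d)`, then the nonzero norms from `K(√d)` are
similarity factors of the form. -/
theorem norm_smul_equivalent_of_isHyperbolic {d : K} [hd : Fact (∀ r : K, r ^ 2 ≠ d + 0 * r)]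
    {x y : K} (hN : x * x - d * (y * y) ≠ 0) (n : ℕ) : ∀ w : Fin n → K, (∀ i, w i ≠ 0) →
      IsHyperbolic (diag (algebraMap K (QuadraticAlgebra K d 0) ∘ w)) →
      ((x * x - d * (y * y)) • diag w).Equivalent (diag w) := by
  have h2 : (2 : K) ≠ 0 := Invertible.ne_zero 2
  have h2' : (2 : QuadraticAlgebra K d 0) ≠ 0 := by
    simpa only [map_ofNat, map_zero] using
      (algebraMap K (QuadraticAlgebra K d 0)).injective.ne h2
  let : Invertible (2 : QuadraticAlgebra K d 0) := invertibleOfNonzero h2'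
  have hd0 : d ≠ 0 := fun h => hd.out 0 (by simp [h])
  induction n using Nat.strong_induction_on with
  | _ n ih =>
    intro w hw hyp
    rcases n with _ | n
    · rw [show (x * x - d * (y * y)) • diag w = diag w by ext; simp]
      exact .refl _
    -- In the anisotropic case a zero `u + v√d` over `K(√d)` yields `w(u) = -d w(v)` and `u ⊥ v`. So
    -- `c⟨-d, 1⟩` with `c = w(v)` splits off over `K`. This binary form has the norms as similarity
    -- factors, and induction applies to its complement.
    by_cases ha : (diag w).Anisotropic
    · have hna := hyp.not_anisotropic
      simp only [QuadraticMap.Anisotropic, not_forall] at hna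
      obtain ⟨z, hz, hz0⟩ := hna
      let u : Fin (n + 1) → K := fun i => (z i).re
      let v : Fin (n + 1) → K := fun i => (z i).im
      have hz' : diag (algebraMap K (QuadraticAlgebra K d 0) ∘ w) z =
          ⟨diag w u + d * diag w v, 2 * ∑ i, w i * (u i * v i)⟩ := by
        rw [diag_apply, diag_apply, diag_apply]
        have (i : Fin (n + 1)) :
            (algebraMap K (QuadraticAlgebra K d 0) ∘ w) i * (z i * z i) =
            (⟨w i * (u i * u i) + d * (w i * (v i * v i)), 2 * (w i * (u i * v i))⟩ :
              QuadraticAlgebra K d 0) := by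
          rw [Function.comp_apply, ← Algebra.smul_def]
          ext <;> simp [u, v] <;> ring
        rw [Finset.sum_congr rfl fun i _ => this i, Finset.mul_sum, Finset.mul_sum,
          ← Finset.sum_add_distrib]
        generalize (Finset.univ : Finset (Fin (n + 1))) = s
        induction s using Finset.cons_induction with
        | empty => rfl
        | cons i s hi ih =>
          rw [Finset.sum_cons, Finset.sum_cons, Finset.sum_cons, ih]
          rfl
      rw [hz] at hz'
      have re : 0 = diag w u + d * diag w v := congrArg QuadraticAlgebra.re hz'
      have im : polar (diag w) u v = 0 := by
        rw [diag_polar]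
        exact (congrArg QuadraticAlgebra.im hz').symm
      have hv : diag w v ≠ 0 := by
        intro hv
        refine hz0 (funext fun i => ?_)
        have h1 := ha u (by rw [re, hv, mul_zero, add_zero])
        have h2 := ha v hv
        exact QuadraticAlgebra.ext (congrFun h1 i) (congrFun h2 i)
      have hu : diag w u = -d * diag w v := by linear_combination -re
      have hu0 : diag w u ≠ 0 := by
        rw [hu]
        exact mul_ne_zero (neg_ne_zero.2 hd0) hv
      obtain ⟨k, w', hw', hk, e⟩ := equivalent_unary_prod_unary_prod_diag
        ((nondegenerate_diag_iff w).2 hw) hu0 hv im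
      rw [Module.finrank_fin_fun] at hk
      rw [hu] at e
      generalize diag w v = c at *
      replace e := e.trans (prod_assoc_equivalent _ _ _).symm
      have e' := e.trans ((diag_pair_equivalent _ _).symm.prod (.refl _))
      have e'' := (diag_map_equivalent (algebraMap K (QuadraticAlgebra K d 0))
        (e'.trans (diag_prod_equivalent _ _)))
      rw [Sum.comp_elim] at e''
      -- Over `K(√d)` the split binary form has the zero `(1, √d)`, so it is a hyperbolic plane and
      -- can be cancelled.
      have hp : (diag (algebraMap K (QuadraticAlgebra K d 0) ∘ ![-d * c, c])).Equivalent
          (hyperbolicPlane _) := by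
        refine equivalent_hyperbolicPlane ((nondegenerate_diag_iff _).2 fun i => ?_) ?_ (by simp)
        · rw [Function.comp_apply, map_ne_zero]
          fin_cases i
          · exact mul_ne_zero (neg_ne_zero.2 hd0) hv
          · exact hv
        · intro h
          have := h ![1, QuadraticAlgebra.omega] (by
            simp [QuadraticAlgebra.omega_mul_omega_eq_algebraMap]
            ring)
          exact one_ne_zero (congrFun this 0)
      have := ih k (by omega) w' hw' (((isHyperbolic_congr
        ((e''.trans (diag_prod_equivalent _ _).symm).trans (hp.prod (.refl _)))).1
          hyp).of_hyperbolicPlane_prod h2')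
      refine ((QForm.smul_equivalent _ e).trans ?_).trans e.symm
      rw [smul_prod]
      exact (norm_smul_equivalent hN).prod this
    · obtain ⟨k, w', hw', hk, e⟩ := equivalent_hyperbolicPlane_prod_diag
        ((nondegenerate_diag_iff w).2 hw) ha
      rw [Module.finrank_fin_fun] at hk
      have := ih k (by omega) w' hw' (((isHyperbolic_congr
        (hyperbolicPlane_prod_diag_map _ e)).1 hyp).of_hyperbolicPlane_prod h2')
      refine ((QForm.smul_equivalent _ e).trans ?_).trans e.symm
      rw [smul_prod]
      exact (smul_hyperbolicPlane_equivalent hN).prod this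

end QuadraticExtension

/-! ### Generic zeros of a diagonal quadratic polynomial. -/

section GenericZero

/-- If `δ` is not a square in the fraction field of `R`, a polynomial over `R` with root `√δ` is a
multiple of `X² - δ`. -/
theorem X_sq_sub_C_dvd_of_eval₂_eq_zero {R D : Type*} [CommRing R] [IsDomain R] [CommRing D]
    [IsDomain D] {δ : R} (hδ : ∀ r s : R, r * r = δ * (s * s) → s = 0) {φ : R →+* D}
    (hφ : Function.Injective φ) {t : D} (ht : t * t = φ δ) {f : Polynomial R}
    (hf : f.eval₂ φ t = 0) : Polynomial.X ^ 2 - Polynomial.C δ ∣ f := by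
  set g : Polynomial R := Polynomial.X ^ 2 - Polynomial.C δ with hg
  have hmonic : g.Monic := Polynomial.monic_X_pow_sub_C δ two_ne_zero
  have hdeg : g.natDegree = 2 := Polynomial.natDegree_X_pow_sub_C
  have hlt : (f %ₘ g).natDegree < 2 := by
    rw [← hdeg]
    exact Polynomial.natDegree_modByMonic_lt f hmonic fun h => by simp [h] at hdeg
  obtain ⟨s, r, hsr⟩ := Polynomial.exists_eq_X_add_C_of_natDegree_le_one (Nat.le_of_lt_succ hlt)
  have hgt : g.eval₂ φ t = 0 := by simp [hg, pow_two, ht]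
  have heval : φ s * t + φ r = 0 := by
    have := congrArg (Polynomial.eval₂ φ t) (Polynomial.modByMonic_add_div f g)
    rw [Polynomial.eval₂_add, Polynomial.eval₂_mul, hgt, hf, hsr] at this
    simpa using this
  -- The remainder `s X + r` vanishes at `t`, so `r² = s² t² = δ s²` after applying `φ`; the
  -- hypothesis on `δ` forces `s = 0`.
  have hs : s = 0 := by
    refine hδ r s (hφ ?_)
    simp only [map_mul]
    linear_combination (φ r - φ s * t) * heval + φ s * φ s * ht
  have hr : r = 0 := hφ (by simpa [hs] using heval)
  rw [← Polynomial.modByMonic_eq_zero_iff_dvd hmonic, hsr, hs, hr]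
  simp

open MvPolynomial

/-- The polynomial `∑ wᵢ Xᵢ²`. -/
def diagPoly {F ι : Type*} [CommRing F] [Fintype ι] (w : ι → F) : MvPolynomial ι F :=
  ∑ i, C (w i) * (X i * X i)

theorem aeval_diagPoly {F ι D : Type*} [CommRing F] [Fintype ι] [CommRing D] [Algebra F D]
    (w : ι → F) (x : ι → D) : aeval x (diagPoly w) = diag (algebraMap F D ∘ w) x := by
  simp [diagPoly]

variable {F : Type*} [Field F]

/-- By degree, a square root would be `c X + d` with `c² = a`, `d² = b` and `2cd = 0`, which is
impossible. -/
theorem sq_ne_mul_X_sq_add (h2 : (2 : F) ≠ 0) {a b : F} (ha : a ≠ 0) (hb : b ≠ 0)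
    (g : Polynomial F) :
    g * g ≠ Polynomial.C a * Polynomial.X ^ 2 + Polynomial.C b := by
  intro h
  have hd : g.natDegree ≤ 1 := by
    have h1 : (g * g).natDegree = 2 := by
      rw [h, Polynomial.natDegree_add_C, Polynomial.natDegree_C_mul_X_pow 2 a ha]
    by_cases hg : g = 0
    · simp [hg]
    · rw [Polynomial.natDegree_mul hg hg] at h1
      omega
  obtain ⟨c, d, rfl⟩ := Polynomial.exists_eq_X_add_C_of_natDegree_le_one hd
  have h' : Polynomial.C (c * c) * Polynomial.X ^ 2 + Polynomial.C (2 * c * d) * Polynomial.X +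
      Polynomial.C (d * d) = Polynomial.C a * Polynomial.X ^ 2 + Polynomial.C b := by
    rw [← h]
    simp only [map_mul, map_ofNat]
    ring
  have e0 := congrArg (Polynomial.coeff · 0) h'
  have e1 := congrArg (Polynomial.coeff · 1) h'
  have e2 := congrArg (Polynomial.coeff · 2) h'
  simp [Polynomial.coeff_X, Polynomial.coeff_C, -map_mul] at e0 e1 e2
  rcases e1 with (h | h) | h
  · exact h2 h
  · exact ha (by rw [← e2, h, zero_mul])
  · exact hb (by rw [← e0, h, zero_mul])

/-- The discriminant of `∑ wᵢ Xᵢ²` with respect to `X₀` is not a square, unless the form is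
the hyperbolic plane. -/
theorem eq_zero_of_mul_self_eq (h2 : (2 : F) ≠ 0) {m : ℕ} (hm : 1 ≤ m) {w : Fin (m + 1) → F}
    (hw : ∀ i, w i ≠ 0) (h1 : m = 1 → (diag w).Anisotropic) (r s : MvPolynomial (Fin m) F)
    (h : r * r = C (-(w 0)⁻¹) * diagPoly (w ∘ Fin.succ) * (s * s)) : s = 0 := by
  by_contra hs
  -- Polynomial rings over a field are integrally closed, so `s² ∣ r²` gives `s ∣ r`, and the
  -- discriminant itself would be a square `g²`.
  have hdvd : s ∣ r := by
    rw [← IsIntegrallyClosed.pow_dvd_pow_iff (n := 2) two_ne_zero]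
    exact ⟨_, by rw [pow_two, pow_two, h, mul_comm]⟩
  obtain ⟨g, rfl⟩ := hdvd
  have hg : g * g = C (-(w 0)⁻¹) * diagPoly (w ∘ Fin.succ) := by
    refine mul_left_cancel₀ (mul_ne_zero hs hs) ?_
    linear_combination h
  obtain rfl | hm := hm.eq_or_lt
  -- For `m = 1`, setting the variable to `1` makes `-w 1 / w 0` a square, against anisotropy.
  · have e := congrArg (aeval (fun _ => (1 : F))) hg
    simp [diagPoly] at e
    have := h1 rfl ![aeval (fun _ => (1 : F)) g, 1] (by
      rw [diag_apply, Fin.sum_univ_two]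
      simp [e]
      field_simp [hw 0]
      ring)
    exact one_ne_zero (congrFun this 1)
  -- For `m ≥ 2`, keeping one variable, setting the next to `1` and the rest to `0` gives `a X² + b`
  -- with `a` and `b` nonzero.
  · obtain ⟨k, rfl⟩ : ∃ k, m = k + 2 := ⟨m - 2, by omega⟩
    have e := congrArg (aeval (Fin.cons Polynomial.X (Fin.cons 1 0) :
      Fin (k + 2) → Polynomial F)) hg
    rw [map_mul, map_mul, aeval_diagPoly, diag_apply, Fin.sum_univ_succ, Fin.sum_univ_succ] at e
    refine sq_ne_mul_X_sq_add h2 (a := -(w 0)⁻¹ * w 1) (b := -(w 0)⁻¹ * w 2)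
      (mul_ne_zero (neg_ne_zero.2 (inv_ne_zero (hw 0))) (hw _))
      (mul_ne_zero (neg_ne_zero.2 (inv_ne_zero (hw 0))) (hw _)) _ (e.trans ?_)
    simp [Polynomial.algebraMap_eq]
    ring

theorem diagPoly_ne_zero {ι : Type*} [Fintype ι] {w : ι → F} (hw : w ≠ 0) : diagPoly w ≠ 0 := by
  classical
  intro h
  obtain ⟨i, hi⟩ := Function.ne_iff.1 hw
  have := congrArg (aeval (Pi.single i (1 : F))) h
  rw [aeval_diagPoly, diag_apply, Finset.sum_eq_single i (by intro j _ hj; simp [hj]) (by simp)]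
    at this
  exact hi (by simpa using this)

theorem aeval_succ_comp (D : Type*) [CommRing D] [Algebra F D] {m : ℕ} (ξ : Fin (m + 1) → D)
    (f : MvPolynomial (Fin (m + 1)) F) : aeval ξ f =
      (finSuccEquiv F m f).eval₂ (aeval (ξ ∘ Fin.succ) : MvPolynomial (Fin m) F →ₐ[F] D).toRingHom
        (ξ 0) := by
  have : (aeval ξ : _ →ₐ[F] D).toRingHom = (Polynomial.eval₂RingHom
      (aeval (ξ ∘ Fin.succ) : MvPolynomial (Fin m) F →ₐ[F] D).toRingHom (ξ 0)).comp
        (finSuccEquiv F m).toRingEquiv.toRingHom := by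
    refine ringHom_ext (fun c => by simp [finSuccEquiv_apply]) fun i => ?_
    refine Fin.cases ?_ (fun i => ?_) i <;> simp [finSuccEquiv_X_zero, finSuccEquiv_X_succ]
  exact DFunLike.congr_fun this f

/-- As a polynomial in `X₀`, the quadric is a unit times the monic `X₀² - δ`; divisibility by it is
thus decided by division with remainder. -/
theorem finSuccEquiv_diagPoly {m : ℕ} {w : Fin (m + 1) → F} (hw : w 0 ≠ 0) :
    finSuccEquiv F m (diagPoly w) = Polynomial.C (C (w 0)) *
      (Polynomial.X ^ 2 - Polynomial.C (C (-(w 0)⁻¹) * diagPoly (w ∘ Fin.succ))) := by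
  have h : Polynomial.C (C (w 0)) * Polynomial.C (C (w 0)⁻¹) =
      (1 : Polynomial (MvPolynomial (Fin m) F)) := by
    rw [← map_mul, ← map_mul, mul_inv_cancel₀ hw, map_one, map_one]
  have h' : finSuccEquiv F m (diagPoly w) = Polynomial.C (C (w 0)) * Polynomial.X ^ 2 +
      Polynomial.C (diagPoly (w ∘ Fin.succ)) := by
    have hC (a : F) : finSuccEquiv F m (C a) = Polynomial.C (C a) := by
      simp [finSuccEquiv_apply]
    simp [diagPoly, Fin.sum_univ_succ, finSuccEquiv_X_zero, finSuccEquiv_X_succ, hC, pow_two]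
  rw [h', map_mul, map_neg, map_neg]
  linear_combination (-Polynomial.C (diagPoly (w ∘ Fin.succ))) * h

/-- A zero of `∑ wᵢ Xᵢ²` with algebraically independent coordinates `ξ₁, …, ξₘ` is a generic zero. -/
theorem diagPoly_dvd_iff (h2 : (2 : F) ≠ 0) {m : ℕ} (hm : 1 ≤ m) {w : Fin (m + 1) → F}
    (hw : ∀ i, w i ≠ 0) (h1 : m = 1 → (diag w).Anisotropic) {D : Type*} [CommRing D] [IsDomain D]
    [Algebra F D] {ξ : Fin (m + 1) → D} (hξ : diag (algebraMap F D ∘ w) ξ = 0)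
    (hinj : Function.Injective (aeval (ξ ∘ Fin.succ) : MvPolynomial (Fin m) F →ₐ[F] D))
    (f : MvPolynomial (Fin (m + 1)) F) : aeval ξ f = 0 ↔ diagPoly w ∣ f := by
  constructor
  · intro hf
    rw [aeval_succ_comp] at hf
    rw [← map_dvd_iff (finSuccEquiv F m), finSuccEquiv_diagPoly (hw 0)]
    have hu : IsUnit (Polynomial.C (C (w 0)) : Polynomial (MvPolynomial (Fin m) F)) :=
      ((IsUnit.mk0 _ (hw 0)).map C).map Polynomial.C
    rw [hu.mul_left_dvd]
    refine X_sq_sub_C_dvd_of_eval₂_eq_zero (fun r s => eq_zero_of_mul_self_eq h2 hm hw h1 r s)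
      hinj ?_ hf
    have e : algebraMap F D (w 0) * algebraMap F D (w 0)⁻¹ = 1 := by
      rw [← map_mul, mul_inv_cancel₀ (hw 0), map_one]
    rw [diag_apply, Fin.sum_univ_succ] at hξ
    have e2 : (aeval (ξ ∘ Fin.succ) : MvPolynomial (Fin m) F →ₐ[F] D).toRingHom
        (C (-(w 0)⁻¹) * diagPoly (w ∘ Fin.succ)) = - algebraMap F D (w 0)⁻¹ *
        ∑ i : Fin m, (algebraMap F D ∘ w) i.succ * (ξ i.succ * ξ i.succ) := by
      change aeval (ξ ∘ Fin.succ) _ = _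
      rw [map_mul, aeval_diagPoly, diag_apply]
      simp
    rw [e2]
    simp only [Function.comp_apply] at hξ ⊢
    linear_combination algebraMap F D (w 0)⁻¹ * hξ - ξ 0 * ξ 0 * e
  · rintro ⟨g, rfl⟩
    rw [map_mul, aeval_diagPoly, hξ, zero_mul]

/-- An isotropic form has a zero in a polynomial ring, all but one of whose coordinates are
algebraically independent. -/
theorem exists_zero_algebraicIndependent (h2 : (2 : F) ≠ 0) {m : ℕ} (hm : 1 ≤ m)
    {w : Fin (m + 1) → F} (hw : ∀ i, w i ≠ 0) (hiso : ¬ (diag w).Anisotropic) :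
    ∃ ξ : Fin (m + 1) → MvPolynomial (Fin (m + 1)) F,
      diag (algebraMap F (MvPolynomial (Fin (m + 1)) F) ∘ w) ξ = 0 ∧
      Function.Injective (aeval (ξ ∘ Fin.succ) :
        MvPolynomial (Fin m) F →ₐ[F] MvPolynomial (Fin (m + 1)) F) := by
  simp only [QuadraticMap.Anisotropic, not_forall] at hiso
  obtain ⟨v, hv, hv0⟩ := hiso
  let S := MvPolynomial (Fin (m + 1)) F
  let p : S := diagPoly w
  let b : S := ∑ i, C (2 * w i * v i) * X i
  -- Stereographic projection from the rational point `v`: `b` is the polar form of `v` and `X`, and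
  -- `p v - b X` is the second point of the quadric on the line through `v` and `X`.
  let ξ : Fin (m + 1) → S := fun i => p * C (v i) - b * X i
  refine ⟨ξ, ?_, ?_⟩
  · have e1 : diag (algebraMap F S ∘ w) ξ = p * p * C (diag w v) - p * b * b + b * b * p := by
      have (i : Fin (m + 1)) : (algebraMap F S ∘ w) i * (ξ i * ξ i) =
          p * p * C (w i * (v i * v i)) - p * b * (C (2 * w i * v i) * X i) +
            b * b * (C (w i) * (X i * X i)) := by
        have hS : algebraMap F S = C := rfl
        simp only [Function.comp_apply, ξ, map_mul, map_ofNat, hS]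
        ring
      rw [diag_apply, diag_apply, Finset.sum_congr rfl fun i _ => this i, Finset.sum_add_distrib,
        Finset.sum_sub_distrib, ← Finset.mul_sum, ← Finset.mul_sum, ← Finset.mul_sum, map_sum]
      rfl
    rw [e1, hv]
    simp; ring
  -- Independence of `ξ₁, …, ξₘ` is tested by specialization. Over `Ω` there is a point of the
  -- quadric `(y₁, Y)` with independent coordinates `Y`, and `ξ` takes the value `(y₁, Y)` at a
  -- multiple of that point. A relation among the `ξᵢ` would then be one among the variables.
  · let R := MvPolynomial (Fin m) F
    let Ω := AlgebraicClosure (FractionRing R)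
    have hι : Function.Injective (algebraMap R Ω) := by
      rw [IsScalarTower.algebraMap_eq R (FractionRing R) Ω]
      exact (algebraMap (FractionRing R) Ω).injective.comp (IsFractionRing.injective _ _)
    let a : F →+* Ω := algebraMap F Ω
    have ha (c : F) : algebraMap R Ω (C c) = a c := (IsScalarTower.algebraMap_apply F R Ω c).symm
    have h2Ω : (2 : Ω) ≠ 0 := by
      simpa only [map_ofNat, map_zero] using a.injective.ne h2
    let Y : Fin m → Ω := fun i => algebraMap R Ω (X i)
    have hs : algebraMap R Ω (diagPoly (w ∘ Fin.succ)) =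
        ∑ i, a (w i.succ) * (Y i * Y i) := by
      simp [diagPoly, ha, Y]
    have hs0 : algebraMap R Ω (diagPoly (w ∘ Fin.succ)) ≠ 0 := by
      refine (map_ne_zero_iff _ hι).2 (diagPoly_ne_zero fun h => hw _ (congrFun h ⟨0, hm⟩))
    obtain ⟨y₀, hy₀⟩ := IsAlgClosed.exists_pow_nat_eq
      (-(a (w 0))⁻¹ * algebraMap R Ω (diagPoly (w ∘ Fin.succ))) two_pos
    have haw : a (w 0) ≠ 0 := (map_ne_zero a).2 (hw 0)
    have hy₀0 : y₀ ≠ 0 := by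
      rintro rfl
      exact mul_ne_zero (neg_ne_zero.2 (inv_ne_zero haw)) hs0 (by rw [← hy₀]; simp)
    have hy₀' : a (w 0) * (y₀ * y₀) = - algebraMap R Ω (diagPoly (w ∘ Fin.succ)) := by
      rw [← pow_two, hy₀, ← mul_assoc, mul_neg, mul_inv_cancel₀ haw, neg_one_mul]
    let β' : Ω := ∑ i, a (w i.succ * v i.succ) * Y i
    -- The point must not be orthogonal to `v`. If `v 0 = 0`, the pairing is a nonzero linear form
    -- in `Y`; otherwise it cannot vanish for both square roots `y₀` and `-y₀`.
    obtain ⟨y₁, hy₁, hβ⟩ : ∃ y₁ : Ω, y₁ * y₁ = y₀ * y₀ ∧ a (w 0 * v 0) * y₁ + β' ≠ 0 := by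
      by_cases hv00 : v 0 = 0
      · refine ⟨y₀, rfl, ?_⟩
        obtain ⟨i, hi⟩ : ∃ i : Fin m, v i.succ ≠ 0 := by
          by_contra! hcon
          exact hv0 (funext fun i => Fin.cases hv00 hcon i)
        have : β' = algebraMap R Ω (∑ i, C (w i.succ * v i.succ) * X i) := by
          rw [map_sum]
          simp only [map_mul, ha, β', Y]
        rw [hv00, mul_zero, map_zero, zero_mul, zero_add, this, map_ne_zero_iff _ hι]
        intro h
        have := congrArg (aeval (Pi.single i (1 : F))) h
        rw [map_sum, Finset.sum_eq_single i (by intro j _ hj; simp [hj]) (by simp)] at this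
        simp [hw, hi] at this
      · by_contra! hcon
        have e1 := hcon y₀ rfl
        have e2 := hcon (-y₀) (by ring)
        have : 2 * a (w 0 * v 0) * y₀ = 0 := by linear_combination e1 - e2
        refine mul_ne_zero (mul_ne_zero h2Ω ?_) hy₀0 this
        exact (map_ne_zero a).2 (mul_ne_zero (hw 0) hv00)
    set β := a (w 0 * v 0) * y₁ + β' with hβdef
    -- At `l • y` one has `p = 0` and `b = 2lβ`, so `ξ = -2l²β y`; the choice of `l` makes this
    -- equal to `y`.
    obtain ⟨l, hl⟩ := IsAlgClosed.exists_pow_nat_eq (-(2 * β)⁻¹) two_pos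
    let y : Fin (m + 1) → Ω := Fin.cons y₁ Y
    have hp : aeval (l • y) p = 0 := by
      rw [aeval_diagPoly, diag_smul, diag_apply, Fin.sum_univ_succ]
      have : a (w 0) * (y₁ * y₁) + ∑ i : Fin m, a (w i.succ) * (Y i * Y i) = 0 := by
        rw [hy₁, hy₀', hs]; ring
      simp only [y, Function.comp_apply, Fin.cons_zero, Fin.cons_succ]
      rw [this, mul_zero]
    have hb : aeval (l • y) b = 2 * l * β := by
      rw [map_sum, Fin.sum_univ_succ, hβdef, mul_add, Finset.mul_sum]
      simp only [y, a, map_mul, aeval_X, algHom_C, Pi.smul_apply, Fin.cons_zero, Fin.cons_succ,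
        smul_eq_mul, map_ofNat]
      congr 1
      · ring
      · exact Finset.sum_congr rfl fun i _ => by ring
    have hξ (i : Fin (m + 1)) : aeval (l • y) (ξ i) = y i := by
      simp only [ξ, map_sub, map_mul, hp, hb, aeval_X, Pi.smul_apply, smul_eq_mul]
      have : l * l * (2 * β) = -1 := by
        rw [← pow_two, hl, neg_mul, inv_mul_cancel₀ (mul_ne_zero h2Ω hβ)]
      linear_combination (-y i) * this
    rw [injective_iff_map_eq_zero]
    intro f hf
    have := congrArg (aeval (l • y)) hf
    rw [map_zero, ← AlgHom.comp_apply, comp_aeval] at this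
    have hY : (fun i => aeval (l • y) ((ξ ∘ Fin.succ) i)) = Y := by
      funext i
      rw [Function.comp_apply, hξ]
      rfl
    rw [hY] at this
    have hf' : aeval Y f = algebraMap R Ω f := by
      have : aeval Y = IsScalarTower.toAlgHom F R Ω := by
        refine algHom_ext fun i => ?_
        rw [aeval_X]; rfl
      rw [this]; rfl
    exact hι (by rw [← hf', this, map_zero])

end GenericZero

open MvPolynomial

/-! ### Linear changes of variables in polynomial rings. -/

section Substitution

variable {F : Type*} [Field F] {ι κ μ : Type*} [Fintype ι] [DecidableEq ι]

/-- The pullback of polynomial functions along a linear map of coordinate spaces. -/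
def linearPullback (A : (ι → F) →ₗ[F] (κ → F)) : MvPolynomial κ F →ₐ[F] MvPolynomial ι F :=
  aeval fun j => ∑ i, C (A (Pi.single i 1) j) * X i

theorem linearPullback_X (A : (ι → F) →ₗ[F] (κ → F)) (j : κ) :
    linearPullback A (X j) = ∑ i, C (A (Pi.single i 1) j) * X i := by
  simp [linearPullback]

theorem linearPullback_comp [Fintype κ] [DecidableEq κ] (A : (ι → F) →ₗ[F] (κ → F)) (B : (κ → F) →ₗ[F] (μ → F)) :
    (linearPullback A).comp (linearPullback B) = linearPullback (B ∘ₗ A) := by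
  refine algHom_ext fun k => ?_
  rw [AlgHom.comp_apply, linearPullback_X, linearPullback_X, map_sum]
  simp only [map_mul, linearPullback_X, algHom_C, algebraMap_eq, Finset.mul_sum]
  rw [Finset.sum_comm]
  refine Finset.sum_congr rfl fun i _ => ?_
  rw [LinearMap.comp_apply, LinearMap.pi_apply_eq_sum_univ B (A (Pi.single i 1)),
    Finset.sum_apply, map_sum, Finset.sum_mul]
  refine Finset.sum_congr rfl fun j _ => ?_
  have : (fun j' => if j = j' then (1 : F) else 0) = Pi.single j 1 := by
    funext j'
    simp [Pi.single_apply, eq_comm]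
  rw [this, Pi.smul_apply, smul_eq_mul, map_mul]
  ring

theorem linearPullback_id :
    linearPullback (LinearMap.id : (ι → F) →ₗ[F] (ι → F)) = AlgHom.id F _ := by
  refine algHom_ext fun j => ?_
  rw [linearPullback_X, Finset.sum_eq_single j (by intro i _ hi; simp [hi.symm]) (by simp)]
  simp

/-- The isomorphism of polynomial rings induced by an isomorphism of coordinate spaces. -/
def linearPullbackEquiv [Fintype κ] [DecidableEq κ] (A : (ι → F) ≃ₗ[F] (κ → F)) :
    MvPolynomial κ F ≃ₐ[F] MvPolynomial ι F :=
  AlgEquiv.ofAlgHom (linearPullback A.toLinearMap) (linearPullback A.symm.toLinearMap)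
    (by rw [linearPullback_comp]; simp [linearPullback_id])
    (by rw [linearPullback_comp]; simp [linearPullback_id])

end Substitution

/-! ### The function field of a quadratic form and its genericity. -/

section FunctionField

variable {F : Type u} [Field F] [Invertible (2 : F)] {V : Type v} [AddCommGroup V] [Module F V]
  [FiniteDimensional F V]

/-- The polynomial of a quadratic form is a linear transform of that of a diagonalization. -/
theorem exists_algEquiv_diagPoly {p : QuadraticForm F V} {k : ℕ} {w : Fin k → F}
    (h : p.Equivalent (diag w)) :
    ∃ Ψ : MvPolynomial (Fin k) F ≃ₐ[F] MvPolynomial (Fin (Module.finrank F V)) F,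
      Ψ (diagPoly w) = toPoly p := by
  have h2 : (2 : F) ≠ 0 := Invertible.ne_zero 2
  obtain ⟨e⟩ := h
  let b := Module.finBasis F V
  let A : (Fin (Module.finrank F V) → F) ≃ₗ[F] (Fin k → F) := b.equivFun.symm.trans e.toLinearEquiv
  refine ⟨linearPullbackEquiv A, ?_⟩
  have hA (i) : A (Pi.single i 1) = e (b i) := by
    change e (b.equivFun.symm (Pi.single i 1)) = e (b i)
    simp
  have hassoc (i j) : QuadraticMap.associated p (b i) (b j) =
      ∑ l, w l * (e (b i) l * e (b j) l) := by
    have h1 : 2 * QuadraticMap.associated p (b i) (b j) = QuadraticMap.polar p (b i) (b j) := by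
      simp [QuadraticMap.associated_apply, QuadraticMap.polar, field]
    have h3 := polar_isometryEquiv e (b i) (b j)
    rw [diag_polar, ← h1] at h3
    exact (mul_left_cancel₀ h2 h3).symm
  change linearPullback A.toLinearMap (diagPoly w) = _
  rw [toPoly, diagPoly, map_sum]
  simp only [map_mul, linearPullback_X, algHom_C, algebraMap_eq, LinearEquiv.coe_coe, hA]
  change _ = ∑ i, ∑ j, C (QuadraticMap.associated p (b i) (b j)) * _
  simp only [hassoc, map_sum, map_mul, Finset.sum_mul, Finset.mul_sum]
  rw [Finset.sum_comm]
  refine Finset.sum_congr rfl fun i _ => ?_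
  rw [Finset.sum_comm]
  refine Finset.sum_congr rfl fun j _ => ?_
  refine Finset.sum_congr rfl fun l _ => ?_
  ring

theorem not_anisotropic_of_isAlgClosed {L : Type*} [Field L] [IsAlgClosed L] {m : ℕ} (hm : 1 ≤ m)
    {w : Fin (m + 1) → L} (hw : ∀ i, w i ≠ 0) : ¬ (diag w).Anisotropic := by
  obtain ⟨k, rfl⟩ : ∃ k, m = k + 1 := ⟨m - 1, by omega⟩
  obtain ⟨a, ha⟩ := IsAlgClosed.exists_pow_nat_eq (-(w 0)⁻¹ * w 1) two_pos
  intro h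
  have := h (Fin.cons a (Fin.cons 1 0)) (by
    rw [diag_apply, Fin.sum_univ_succ, Fin.sum_univ_succ]
    simp [← pow_two, ha, hw 0])
  exact one_ne_zero (congrFun this 1)

/-- The function field of a nondegenerate quadratic form of dimension at least two is a field over
which the form is isotropic, and it is generic with that property. -/
theorem exists_field_functionField {p : QuadraticForm F V} (hp : p.Nondegenerate)
    (hd : 2 ≤ Module.finrank F V) :
    ∃ (K : Type u) (_ : Field K) (_ : Algebra F K),
      Nonempty (functionField p ≃ₐ[F] K) ∧ ¬ (p.baseChange K).Anisotropic ∧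
      ∀ (L : Type u) [Field L] [Algebra F L], ¬ (p.baseChange L).Anisotropic →
        ∀ (n : ℕ) (w : Fin n → F), (∀ i, w i ≠ 0) →
          IsHyperbolic (diag (algebraMap F K ∘ w)) → IsHyperbolic (diag (algebraMap F L ∘ w)) := by
  have h2 : (2 : F) ≠ 0 := Invertible.ne_zero 2
  by_cases hhyp : p.Equivalent (hyperbolicPlane F)
  · refine ⟨F, inferInstance, inferInstance, ?_, ?_, ?_⟩
    · rw [functionField, if_pos (Or.inr hhyp)]
      exact ⟨AlgEquiv.refl⟩
    · rw [anisotropic_congr (baseChange_equivalent_diag F hhyp)]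
      exact not_anisotropic_of_injective (φ := algebraMap F F) (RingHom.injective _)
        hyperbolicPlane_not_anisotropic
    · intro L _ _ _ n w _ h
      exact h.diag_map (algebraMap F L)
  · obtain ⟨w', hw', e'⟩ := exists_diag_equivalent hp
    obtain ⟨m, hm⟩ : ∃ m, Module.finrank F V = m + 1 := ⟨Module.finrank F V - 1, by omega⟩
    obtain ⟨w, hw, e⟩ : ∃ w : Fin (m + 1) → F, (∀ i, w i ≠ 0) ∧ p.Equivalent (diag w) :=
      ⟨w' ∘ finCongr hm.symm, fun i => hw' _, e'.trans (diag_reindex_equivalent _ _)⟩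
    have hm1 : 1 ≤ m := by omega
    have h1 : m = 1 → (diag w).Anisotropic := by
      rintro rfl
      by_contra hcon
      exact hhyp (e.trans (equivalent_hyperbolicPlane ((nondegenerate_diag_iff w).2 hw) hcon
        (by simp)))
    -- An isotropy field `L` yields a zero of the quadric in `L[X₀, …, Xₘ]` whose last `m`
    -- coordinates are independent over `L`, hence over `F`. Evaluation there has kernel exactly
    -- `(diagPoly w)`.
    have hiso (L : Type u) [Field L] [Algebra F L] (hL : ¬ (p.baseChange L).Anisotropic) :
        ∃ θ : MvPolynomial (Fin (m + 1)) F →ₐ[F] MvPolynomial (Fin (m + 1)) L,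
          (∀ f, θ f = 0 ↔ diagPoly w ∣ f) ∧ ∀ j : Fin m, θ (X j.succ) ≠ 0 := by
      rw [anisotropic_congr (baseChange_equivalent_diag L e)] at hL
      have h2L : (2 : L) ≠ 0 := by
        simpa only [map_ofNat, map_zero] using (algebraMap F L).injective.ne h2
      obtain ⟨ξ, hξ, hinj⟩ := exists_zero_algebraicIndependent h2L hm1
        (fun i => (map_ne_zero (algebraMap F L)).2 (hw i)) hL
      have hinj' : Function.Injective (aeval (ξ ∘ Fin.succ) :
          MvPolynomial (Fin m) F →ₐ[F] MvPolynomial (Fin (m + 1)) L) := by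
        have hc : ⇑(aeval (ξ ∘ Fin.succ) : MvPolynomial (Fin m) F →ₐ[F] _) =
            (aeval (ξ ∘ Fin.succ) : MvPolynomial (Fin m) L →ₐ[L] _) ∘ map (algebraMap F L) := by
          funext f
          exact (aeval_map_algebraMap L _ f).symm
        rw [hc]
        exact hinj.comp (map_injective _ (algebraMap F L).injective)
      refine ⟨aeval ξ, diagPoly_dvd_iff h2 hm1 hw h1 ?_ hinj', fun j => ?_⟩
      · exact hξ
      · have := (map_ne_zero_iff _ hinj').2 (X_ne_zero (R := F) j)
        simpa using this
    obtain ⟨Ψ, hΨ⟩ := exists_algEquiv_diagPoly e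
    let S := MvPolynomial (Fin (Module.finrank F V)) F
    let I : Ideal S := Ideal.span {toPoly p}
    have hI (L : Type u) [Field L] [Algebra F L] (hL : ¬ (p.baseChange L).Anisotropic) :
        ∃ θ : S →ₐ[F] MvPolynomial (Fin (m + 1)) L,
          I = RingHom.ker θ ∧ ∀ j : Fin m, θ (Ψ (X j.succ)) ≠ 0 := by
      obtain ⟨θ, hθ, hθ'⟩ := hiso L hL
      refine ⟨θ.comp Ψ.symm, ?_, fun j => by simpa using hθ' j⟩
      ext f
      rw [Ideal.mem_span_singleton, RingHom.mem_ker, AlgHom.comp_apply]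
      change _ ↔ θ (Ψ.symm f) = 0
      rw [hθ, ← hΨ, ← map_dvd_iff Ψ]
      simp
    -- The algebraic closure always makes `p` isotropic. The ideal of `p` is then the kernel of a
    -- map to a domain, hence prime, and the coordinate classes not all vanish.
    obtain ⟨θ₀, hθ₀, hθ₀'⟩ := hI (AlgebraicClosure F) (by
      rw [anisotropic_congr (baseChange_equivalent_diag _ e)]
      exact not_anisotropic_of_isAlgClosed hm1 fun i => (map_ne_zero _).2 (hw i))
    have hprime : I.IsPrime := by rw [hθ₀]; exact RingHom.ker_isPrime _
    let K := FractionRing (S ⧸ I)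
    have hinjK : Function.Injective (algebraMap (S ⧸ I) K) := IsFractionRing.injective _ _
    refine ⟨K, inferInstance, inferInstance, ?_, ?_, ?_⟩
    · rw [functionField, if_neg (by rw [not_or]; exact ⟨by omega, hhyp⟩)]
      exact ⟨AlgEquiv.refl⟩
    · rw [anisotropic_congr (baseChange_equivalent_diag _ e)]
      intro h
      let η : MvPolynomial (Fin (m + 1)) F →ₐ[F] K :=
        ((IsScalarTower.toAlgHom F (S ⧸ I) K).comp (Ideal.Quotient.mkₐ F I)).comp Ψ.toAlgHom
      have hη (f) : η f = algebraMap (S ⧸ I) K (Ideal.Quotient.mk I (Ψ f)) := rfl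
      have h0 := h (fun i => η (X i)) (by
        rw [← aeval_diagPoly, show (aeval fun i => η (X i)) = η from (aeval_unique η).symm, hη, hΨ,
          Ideal.Quotient.eq_zero_iff_mem.2 (Ideal.mem_span_singleton_self _), map_zero])
      have h3 := congrFun h0 (Fin.succ ⟨0, hm1⟩)
      rw [Pi.zero_apply, hη, map_eq_zero_iff _ hinjK, Ideal.Quotient.eq_zero_iff_mem, hθ₀] at h3
      exact hθ₀' _ h3
    -- The evaluation embeds `F(p)` into `L(X₀, …, Xₘ)`. Hyperbolicity goes up along this embedding
    -- and then down to `L`, since anisotropy over `L` survives in `L(X₀, …, Xₘ)`.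
    · intro L _ _ hL n w hw h
      obtain ⟨θ, hθ, -⟩ := hI L hL
      let L' := FractionRing (MvPolynomial (Fin (m + 1)) L)
      let θ' : S ⧸ I →ₐ[F] MvPolynomial (Fin (m + 1)) L :=
        Ideal.Quotient.liftₐ I θ fun a ha => by rw [hθ] at ha; exact ha
      have hθ' : Function.Injective θ' := by
        rw [injective_iff_map_eq_zero]
        intro a ha
        obtain ⟨a, rfl⟩ := Ideal.Quotient.mk_surjective a
        rw [Ideal.Quotient.eq_zero_iff_mem, hθ]
        exact ha
      let ψ : K →+* L' := IsFractionRing.map hθ'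
      have hψ (a : F) : ψ (algebraMap F K a) = algebraMap (MvPolynomial (Fin (m + 1)) L) L' (C (algebraMap F L a)) := by
        rw [IsScalarTower.algebraMap_apply F (S ⧸ I) K]
        refine (IsLocalization.map_eq _ _).trans (congrArg _ ?_)
        exact θ'.commutes a
      let : Invertible (2 : K) := invertibleTwo F K
      let : Invertible (2 : L) := invertibleTwo F L
      have h3 := h.diag_map ψ
      have h4 : (ψ ∘ algebraMap F K ∘ w) =
          ((algebraMap (MvPolynomial (Fin (m + 1)) L) L').comp C : L →+* L') ∘ (algebraMap F L ∘ w) :=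
        funext fun i => hψ (w i)
      rw [h4] at h3
      refine IsHyperbolic.of_map _ (fun n w _ ha => ?_)
        (fun i => (map_ne_zero _).2 (hw i)) h3
      exact anisotropic_fractionRing (R := MvPolynomial (Fin (m + 1)) L) (K := L') (anisotropic_mvPolynomial ha (m + 1))

end FunctionField

/-! ### Similarity factors from isotropy of `p ⊥ -ap`. -/

section Similarity

theorem diag_smul_add_smul {R ι : Type*} [CommRing R] [Fintype ι] (w u v : ι → R) (b c : R) :
    diag w (b • u + c • v) =
      b * b * diag w u + 2 * b * c * ∑ i, w i * (u i * v i) + c * c * diag w v := by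
  simp only [diag_apply, Finset.mul_sum, ← Finset.sum_add_distrib]
  exact Finset.sum_congr rfl fun i _ => by simp; ring

/-- Regrouping the coordinates with the same index gives an orthogonal sum of scaled planes `w i ⟨1,
-1⟩`, each isometric to the hyperbolic plane. -/
theorem isHyperbolic_perpNeg_one {K : Type*} [Field K] [Invertible (2 : K)] {n : ℕ}
    {w : Fin n → K} (hw : ∀ i, w i ≠ 0) : IsHyperbolic (perpNeg 1 (diag w)) := by
  refine ⟨n, ?_⟩
  have h1 : (perpNeg 1 (diag w)).Equivalent (pi fun i : Fin n => w i • hyperbolicPlane K) :=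
    ⟨{ toFun := fun z i => ![z.1 i, z.2 i]
       invFun := fun z => (fun i => z i 0, fun i => z i 1)
       map_add' := fun z z' => by ext i j; fin_cases j <;> simp
       map_smul' := fun a z => by ext i j; fin_cases j <;> simp
       left_inv := fun z => by simp
       right_inv := fun z => by ext i j; fin_cases j <;> simp
       map_app' := fun z => by
        simp [perpNeg, pi_apply, hyperbolicPlane, weightedSumSquares_apply, mul_add,
          Finset.sum_add_distrib] }⟩
  exact h1.trans (Equivalent.pi fun i => smul_hyperbolicPlane_equivalent (hw i))

theorem isHyperbolic_perpNeg_of_smul_equivalent {K : Type*} [Field K] [Invertible (2 : K)]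
    {V : Type*} [AddCommGroup V] [Module K V] {n : ℕ} {w : Fin n → K} (hw : ∀ i, w i ≠ 0)
    {Q : QuadraticForm K V} (hQ : Q.Equivalent (diag w)) {a : K} (ha : (a • Q).Equivalent Q) :
    IsHyperbolic (perpNeg a Q) := by
  have h1 : ((-a) • Q).Equivalent ((-1 : K) • Q) := by
    have := smul_equivalent (-1 : K) ha
    rwa [smul_smul, neg_one_mul] at this
  have h2 : (perpNeg a Q).Equivalent (perpNeg 1 Q) := (Equivalent.refl Q).prod h1
  exact (isHyperbolic_congr (h2.trans (perpNeg_equivalent 1 hQ))).2 (isHyperbolic_perpNeg_one hw)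

/-- Suppose that `q` is hyperbolic over each extension of `K` over which `p` is isotropic. Then the
quotients of nonzero values of `p` are similarity factors of `q`. -/
theorem smul_equivalent_of_perpNeg_not_anisotropic {K : Type u} [Field K] [Invertible (2 : K)]
    {k n : ℕ} {w : Fin k → K} {w' : Fin n → K} (hw' : ∀ i, w' i ≠ 0)
    (h : ∀ (L : Type u) [Field L] [Algebra K L], ¬ (diag (algebraMap K L ∘ w)).Anisotropic →
      IsHyperbolic (diag (algebraMap K L ∘ w'))) {a : K} (ha : a ≠ 0)
    (hiso : ¬ (perpNeg a (diag w)).Anisotropic) : (a • diag w').Equivalent (diag w') := by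
  by_cases hp : (diag w).Anisotropic
  · simp only [QuadraticMap.Anisotropic, not_forall] at hiso
    obtain ⟨⟨u, v⟩, huv, huv0⟩ := hiso
    have huv' : diag w u = a * diag w v := by
      simp only [perpNeg, prod_apply, smul_apply, smul_eq_mul] at huv
      linear_combination huv
    set β := diag w v with hβ
    have hβ0 : β ≠ 0 := by
      intro h0
      rw [h0, mul_zero] at huv'
      exact huv0 (by rw [hp u huv', hp v h0]; rfl)
    set B := ∑ i, w i * (u i * v i) with hB
    -- Minus the Gram determinant of `u, v`. For `e² = d`, the vector `β u + (e - B) v` is a zero of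
    -- the form. So if `d` is a square in `K`, anisotropy makes that vector vanish and `a` is a
    -- square; otherwise the same vector is a zero over `K(√d)`.
    obtain ⟨d, hd⟩ : ∃ d, d = B * B - diag w u * β := ⟨_, rfl⟩
    by_cases hsq : ∃ e, e * e = d
    · obtain ⟨e, he⟩ := hsq
      have h0 := hp (β • u + (e - B) • v) (by
        rw [diag_smul_add_smul, ← hB, ← hβ]
        linear_combination β * he + β * hd)
      have h1 : β • u = (B - e) • v := by
        rw [← sub_eq_zero, ← h0, ← neg_sub e B, neg_smul, sub_neg_eq_add]
      have h2 : β * β * diag w u = (B - e) * (B - e) * β := by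
        rw [← diag_smul, h1, diag_smul]
      have h3 : a = (B - e) / β * ((B - e) / β) := by
        rw [huv'] at h2
        field_simp
        exact mul_right_cancel₀ hβ0 (by linear_combination h2)
      have h4 : (B - e) / β ≠ 0 := fun h4 => ha (by rw [h3, h4, mul_zero])
      rw [h3]
      exact smul_mul_self_equivalent _ (Units.mk0 _ h4)
    · have hd' : Fact (∀ r : K, r ^ 2 ≠ d + 0 * r) :=
        ⟨fun r hr => hsq ⟨r, by linear_combination hr⟩⟩
      let L := QuadraticAlgebra K d 0
      let φ := algebraMap K L
      let ω : L := QuadraticAlgebra.omega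
      have hω : ω * ω = φ d := QuadraticAlgebra.omega_mul_omega_eq_mk
      have hyp := h L (by
        intro hL
        have h0 := hL (φ β • (φ ∘ u) + (ω - φ B) • (φ ∘ v)) (by
          have hB' : ∑ i, (φ ∘ w) i * ((φ ∘ u) i * (φ ∘ v) i) = φ B := by
            rw [hB, map_sum]
            simp
          rw [diag_smul_add_smul, map_diag, map_diag, hB', ← hβ]
          have hd2 : φ d = φ B * φ B - φ (diag w u) * φ β :=
            (congrArg φ hd).trans (by simp)
          linear_combination φ β * hω + φ β * hd2)
        obtain ⟨i, hi⟩ : ∃ i, v i ≠ 0 := by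
          by_contra! hcon
          exact hβ0 (by rw [hβ, show v = 0 from funext hcon, QuadraticMap.map_zero])
        have h1 : (⟨β, 0⟩ * ⟨u i, 0⟩ + (⟨0, 1⟩ - ⟨B, 0⟩) * ⟨v i, 0⟩ : QuadraticAlgebra K d 0).im = 0 :=
          congrArg QuadraticAlgebra.im (congrFun h0 i)
        exact hi (by simpa using h1))
      -- The norm of `B + √d` is `B² - d = w(u) w(v) = a β²`, which equals `a` up to a square.
      have key := norm_smul_equivalent_of_isHyperbolic (d := d) (x := B) (y := 1) (by
        rw [hd, huv']
        ring_nf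
        exact mul_ne_zero ha (pow_ne_zero 2 hβ0)) n w' hw' hyp
      have e1 : B * B - d * (1 * 1) = a * (β * β) := by
        rw [hd, huv']; ring
      rw [e1, ← smul_smul] at key
      exact (smul_equivalent a (smul_mul_self_equivalent (diag w') (Units.mk0 β hβ0)).symm).trans key
  · exact (h K hp).smul_equivalent ha

end Similarity

/-! ### Coordinates for `p ⊥ -xp` and `p ⊥ ⟨-x⟩` after iterated scalar extension. -/

section BaseChange

theorem perpNeg_baseChange_equivalent {F E L : Type*} [Field F] [Invertible (2 : F)] [Field E]
    [Invertible (2 : E)] [Algebra F E] [CommRing L] [Algebra E L] {V : Type*} [AddCommGroup V]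
    [Module F V] {ι : Type*} [Fintype ι] {p : QuadraticForm F V} {w : ι → F}
    (h : p.Equivalent (diag w)) (x : E) :
    ((perpNeg x (p.baseChange E)).baseChange L).Equivalent
      (perpNeg (algebraMap E L x) (diag (algebraMap E L ∘ algebraMap F E ∘ w))) := by
  have h1 := (perpNeg_equivalent x (baseChange_equivalent_diag E h)).trans
    (perpNeg_diag_equivalent _ _)
  refine (baseChange_equivalent_diag L h1).trans ?_
  rw [Sum.comp_elim]
  convert (perpNeg_diag_equivalent _ _).symm using 3
  funext i
  simp

theorem perpNegUnary_equivalent {R M : Type*} [CommRing R] [AddCommGroup M] [Module R M] {ι : Type*}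
    [Fintype ι] {p : QuadraticForm R M} {w : ι → R} (h : p.Equivalent (diag w)) (x : R) :
    (perpNegUnary p x).Equivalent (diag (Sum.elim w fun _ : Unit => -x)) := by
  refine (h.prod ?_).trans (diag_prod_equivalent _ _)
  exact ⟨{ (LinearEquiv.funUnique Unit R R).symm with map_app' := fun y => by simp }⟩

theorem perpNegUnary_baseChange_equivalent {F E L : Type*} [Field F] [Invertible (2 : F)] [Field E]
    [Invertible (2 : E)] [Algebra F E] [CommRing L] [Algebra E L] {V : Type*} [AddCommGroup V]
    [Module F V] {ι : Type*} [Fintype ι] {p : QuadraticForm F V} {w : ι → F}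
    (h : p.Equivalent (diag w)) (x : E) :
    ((perpNegUnary (p.baseChange E) x).baseChange L).Equivalent
      (perpNegUnary (diag (algebraMap E L ∘ algebraMap F E ∘ w)) (algebraMap E L x)) := by
  refine (baseChange_equivalent_diag L (perpNegUnary_equivalent
    (baseChange_equivalent_diag E h) x)).trans ?_
  rw [Sum.comp_elim]
  convert (perpNegUnary_equivalent (p := diag (algebraMap E L ∘ algebraMap F E ∘ w)) (.refl _)
    (algebraMap E L x)).symm using 3
  funext i
  simp

theorem nondegenerate_baseChange {F E : Type*} [Field F] [Invertible (2 : F)] [Field E]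
    [Invertible (2 : E)] [Algebra F E] {V : Type*} [AddCommGroup V] [Module F V]
    [FiniteDimensional F V] {p : QuadraticForm F V} (hp : p.Nondegenerate) :
    (p.baseChange E).Nondegenerate := by
  obtain ⟨w, hw, e⟩ := exists_diag_equivalent hp
  exact nondegenerate_congr (baseChange_equivalent_diag E e).symm
    ((nondegenerate_diag_iff _).2 fun i => (map_ne_zero _).2 (hw i))

theorem isHyperbolic_baseChange_of_algHom {F A B : Type*} [Field F] [Invertible (2 : F)]
    [CommRing A] [Algebra F A] [CommRing B] [Algebra F B] {V : Type*} [AddCommGroup V] [Module F V]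
    [FiniteDimensional F V] {q : QuadraticForm F V} (φ : A →ₐ[F] B)
    (h : IsHyperbolic (q.baseChange A)) : IsHyperbolic (q.baseChange B) := by
  obtain ⟨w, hw⟩ := q.equivalent_weightedSumSquares
  let : Invertible (2 : A) := invertibleTwo F A
  have := ((isHyperbolic_congr (baseChange_equivalent_diag A hw)).1 h).diag_map φ.toRingHom
  refine (isHyperbolic_congr (baseChange_equivalent_diag B hw)).2 ?_
  convert this using 2
  funext i
  exact (φ.commutes _).symm

end BaseChange

/-! ### Functoriality of Laurent series in the coefficient field. -/

section LaurentMap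

variable {F K : Type*} [Field F] [Field K]

/-- The homomorphism of Laurent series fields induced by a field homomorphism. -/
def laurentMap (φ : F →+* K) : LaurentSeries F →+* LaurentSeries K :=
  IsFractionRing.map (A := PowerSeries F) (B := PowerSeries K) (j := PowerSeries.map φ)
    (PowerSeries.map_injective φ φ.injective)

theorem laurentMap_algebraMap_powerSeries (φ : F →+* K) (f : PowerSeries F) :
    laurentMap φ (algebraMap (PowerSeries F) (LaurentSeries F) f) =
      algebraMap (PowerSeries K) (LaurentSeries K) (PowerSeries.map φ f) :=
  IsLocalization.map_eq (S := LaurentSeries F) (Q := LaurentSeries K)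
    (M := nonZeroDivisors (PowerSeries F)) (T := nonZeroDivisors (PowerSeries K))
    (nonZeroDivisors_le_comap_nonZeroDivisors_of_injective _
      (PowerSeries.map_injective φ φ.injective)) f

theorem laurentMap_laurentX (φ : F →+* K) : laurentMap φ (laurentX F) = laurentX K := by
  rw [← algebraMap_powerSeries_X, laurentMap_algebraMap_powerSeries, PowerSeries.map_X,
    algebraMap_powerSeries_X]

theorem laurentMap_algebraMap (φ : F →+* K) (a : F) :
    laurentMap φ (algebraMap F (LaurentSeries F) a) = algebraMap K (LaurentSeries K) (φ a) := by
  rw [← algebraMap_powerSeries_C, laurentMap_algebraMap_powerSeries, PowerSeries.map_C,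
    algebraMap_powerSeries_C]

end LaurentMap

theorem two_le_finrank_baseChange_prod {F E V : Type*} [Field F] [Field E] [Algebra F E]
    [AddCommGroup V] [Module F V] (hd : 2 ≤ Module.finrank F V) (U : Type*) [AddCommGroup U]
    [Module E U] [FiniteDimensional F V] [FiniteDimensional E U] :
    2 ≤ Module.finrank E (TensorProduct F E V × U) := by
  rw [Module.finrank_prod, Module.finrank_baseChange]
  omega

/-! ### Transfer of hyperbolicity between function fields. -/

section FunctionField

variable {F : Type u} [Field F] [Invertible (2 : F)]
    {V : Type v} [AddCommGroup V] [Module F V] [FiniteDimensional F V]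
    {W : Type w} [AddCommGroup W] [Module F W] [FiniteDimensional F W]

/-- A form that is hyperbolic over the function field of `p` is hyperbolic over each extension over
which `p` is isotropic. -/
theorem IsHyperbolic.baseChange_of_functionField {p : QuadraticForm F V} {q : QuadraticForm F W}
    (hp : p.Nondegenerate) (hq : q.Nondegenerate) (hd : 2 ≤ Module.finrank F V)
    (h : IsHyperbolic (q.baseChange (functionField p))) (L : Type u) [Field L] [Algebra F L]
    (hL : ¬ (p.baseChange L).Anisotropic) : IsHyperbolic (q.baseChange L) := by
  obtain ⟨K, _, _, ⟨e⟩, -, hK⟩ := exists_field_functionField hp hd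
  obtain ⟨w, hw, ew⟩ := exists_diag_equivalent hq
  have h1 := isHyperbolic_baseChange_of_algHom e.toAlgHom h
  rw [isHyperbolic_congr (baseChange_equivalent_diag _ ew)] at h1 ⊢
  exact hK L hL _ w hw h1

/-- Function fields are isotropy fields: there is a field extension `K / F` isomorphic to the
function field, and `p` is isotropic over it. -/
theorem exists_isotropic_functionField {p : QuadraticForm F V} (hp : p.Nondegenerate)
    (hd : 2 ≤ Module.finrank F V) :
    ∃ (K : Type u) (_ : Field K) (_ : Algebra F K),
      ¬ (p.baseChange K).Anisotropic ∧ Nonempty (functionField p ≃ₐ[F] K) := by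
  obtain ⟨K, i, j, e, h, -⟩ := exists_field_functionField hp hd
  exact ⟨K, i, j, h, e⟩

/-- An extension of `K` over which `p` is isotropic is also an extension of `F`, so genericity of
`F(p)` makes `q` hyperbolic there. This is the hypothesis of
`smul_equivalent_of_perpNeg_not_anisotropic` over `K`. -/
theorem H_subset_G {p : QuadraticForm F V} {q : QuadraticForm F W}
    (hp : p.Nondegenerate) (hq : q.Nondegenerate) (hd : 2 ≤ Module.finrank F V)
    (h : IsHyperbolic (q.baseChange (functionField p))) (K : Type u) [Field K] [Algebra F K] :
    H (p.baseChange K) ⊆ G (q.baseChange K) := by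
  let : Invertible (2 : K) := invertibleTwo F K
  intro a ha
  change ¬ (perpNeg (a : K) (p.baseChange K)).Anisotropic at ha
  change ((a : K) • q.baseChange K).Equivalent (q.baseChange K)
  obtain ⟨w, hw, ew⟩ := exists_diag_equivalent hp
  obtain ⟨w', hw', ew'⟩ := exists_diag_equivalent hq
  rw [anisotropic_congr (perpNeg_equivalent _ (baseChange_equivalent_diag K ew))] at ha
  have e := baseChange_equivalent_diag K ew'
  refine ((smul_equivalent _ e).trans ?_).trans e.symm
  refine smul_equivalent_of_perpNeg_not_anisotropic (fun i => (map_ne_zero _).2 (hw' i))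
    (fun L _ _ hL => ?_) a.ne_zero ha
  let : Algebra F L := ((algebraMap K L).comp (algebraMap F K)).toAlgebra
  have := h.baseChange_of_functionField hp hq hd L (by
    rwa [anisotropic_congr (baseChange_equivalent_diag L ew)])
  rwa [isHyperbolic_congr (baseChange_equivalent_diag L ew')] at this

/-- Suppose that `P` is a form over `F((x))` that is isotropic over `K((x))` whenever `p` is
isotropic over `K`. If `q ⊥ -xq` is hyperbolic over the function field of `P`, then `q` is
hyperbolic over the function field of `p`. -/
theorem isHyperbolic_functionField_of_laurent {p : QuadraticForm F V} {q : QuadraticForm F W}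
    (hp : p.Nondegenerate) (hq : q.Nondegenerate) (hd : 2 ≤ Module.finrank F V)
    {U : Type*} [AddCommGroup U] [Module (LaurentSeries F) U]
    [FiniteDimensional (LaurentSeries F) U] {P : QuadraticForm (LaurentSeries F) U}
    (hP : P.Nondegenerate) (hdP : 2 ≤ Module.finrank (LaurentSeries F) U)
    (hiso : ∀ (K : Type u) [Field K] [Algebra F K], ¬ (p.baseChange K).Anisotropic →
      ∀ [Algebra (LaurentSeries F) (LaurentSeries K)],
        algebraMap (LaurentSeries F) (LaurentSeries K) = laurentMap (algebraMap F K) →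
          ¬ (P.baseChange (LaurentSeries K)).Anisotropic)
    (h : IsHyperbolic ((perpNeg (laurentX F) (q.baseChange (LaurentSeries F))).baseChange
      (functionField P))) :
    IsHyperbolic (q.baseChange (functionField p)) := by
  obtain ⟨K, _, _, hK, ⟨e⟩⟩ := exists_isotropic_functionField hp hd
  -- With `K` a copy of `F(p)`, `P` is isotropic over `K((x))`, so genericity of its function field
  -- makes `q ⊥ -xq` hyperbolic over `K((x))`, from which hyperbolicity of `q` descends to `K`.
  refine isHyperbolic_baseChange_of_algHom e.symm.toAlgHom ?_
  let : Invertible (2 : K) := invertibleTwo F K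
  let : Algebra (LaurentSeries F) (LaurentSeries K) := (laurentMap (algebraMap F K)).toAlgebra
  have halg : algebraMap (LaurentSeries F) (LaurentSeries K) = laurentMap (algebraMap F K) := rfl
  have hq' := nondegenerate_baseChange (E := LaurentSeries F) hq
  have h1 := h.baseChange_of_functionField hP
    (nondegenerate_prod hq' (nondegenerate_smul hq' (neg_ne_zero.2 laurentX_ne_zero))) hdP
    (LaurentSeries K) (hiso K hK halg)
  obtain ⟨w, hw, ew⟩ := exists_diag_equivalent hq
  rw [isHyperbolic_congr (perpNeg_baseChange_equivalent ew _), halg, laurentMap_laurentX] at h1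
  rw [isHyperbolic_congr (baseChange_equivalent_diag K ew)]
  refine IsHyperbolic.of_perpNeg_laurentX (fun i => (map_ne_zero _).2 (hw i)) ?_
  have hc : algebraMap K (LaurentSeries K) ∘ (algebraMap F K ∘ w) =
      laurentMap (algebraMap F K) ∘ algebraMap F (LaurentSeries F) ∘ w :=
    funext fun i => (laurentMap_algebraMap _ _).symm
  rw [hc]
  exact h1

/-- Suppose that `P` is a form over `F((x))` such that `x` is a similarity factor of `q` over each
extension over which `P` is isotropic. Then `q ⊥ -xq` is hyperbolic over the function field of
`P`. -/
theorem isHyperbolic_perpNeg_functionField {q : QuadraticForm F W} (hq : q.Nondegenerate)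
    {E : Type u} [Field E] [Invertible (2 : E)] [Algebra F E] {x : E}
    {U : Type*} [AddCommGroup U] [Module E U] [FiniteDimensional E U] {P : QuadraticForm E U}
    (hP : P.Nondegenerate) (hdP : 2 ≤ Module.finrank E U)
    (hG : ∀ (K : Type u) [Field K] [Algebra E K] [Algebra F K] [IsScalarTower F E K],
      ¬ (P.baseChange K).Anisotropic →
        (algebraMap E K x • q.baseChange K).Equivalent (q.baseChange K)) :
    IsHyperbolic ((perpNeg x (q.baseChange E)).baseChange (functionField P)) := by
  -- The function field of `P` itself serves as the test extension: `P` is isotropic over it, so `xq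
  -- ≃ q` and `q ⊥ -xq ≃ q ⊥ -q` there.
  obtain ⟨K, _, _, hK, ⟨e⟩⟩ := exists_isotropic_functionField hP hdP
  obtain ⟨w, hw, ew⟩ := exists_diag_equivalent hq
  refine isHyperbolic_baseChange_of_algHom e.symm.toAlgHom ?_
  let : Invertible (2 : K) := invertibleTwo E K
  let : Algebra F K := ((algebraMap E K).comp (algebraMap F E)).toAlgebra
  have : IsScalarTower F E K := .of_algebraMap_eq fun _ => rfl
  have hG' := hG K hK
  have e1 := baseChange_equivalent_diag K ew
  rw [isHyperbolic_congr (perpNeg_baseChange_equivalent ew x)]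
  refine isHyperbolic_perpNeg_of_smul_equivalent (w := algebraMap F K ∘ w)
    (fun i => (map_ne_zero _).2 (hw i)) (.refl _) ?_
  exact ((smul_equivalent _ e1.symm).trans hG').trans e1

end FunctionField

/-! ### Isotropy of `Q ⊥ -xQ` and `Q ⊥ ⟨-x⟩`. -/

section Isotropy

variable {K : Type*} [Field K] {ι : Type*} [Fintype ι] {w : ι → K} {x : K}

theorem perpNeg_not_anisotropic {V : Type*} [AddCommGroup V] [Module K V] {Q : QuadraticForm K V}
    (h : ¬ Q.Anisotropic) : ¬ (perpNeg x Q).Anisotropic :=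
  fun h' => h (anisotropic_of_prod h').1

theorem perpNegUnary_not_anisotropic {V : Type*} [AddCommGroup V] [Module K V]
    {Q : QuadraticForm K V} (h : ¬ Q.Anisotropic) : ¬ (perpNegUnary Q x).Anisotropic :=
  fun h' => h (anisotropic_of_prod h').1

/-- For anisotropic `Q`, a zero `(y, t)` has `t ≠ 0` and `t⁻¹ y` has value `x`; an isotropic
nondegenerate `Q` represents every scalar. -/
theorem exists_eq_of_perpNegUnary_not_anisotropic [Invertible (2 : K)] {V : Type*} [AddCommGroup V]
    [Module K V] {Q : QuadraticForm K V} (hQ : Q.Nondegenerate)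
    (h : ¬ (perpNegUnary Q x).Anisotropic) : ∃ y, Q y = x := by
  by_cases hQa : Q.Anisotropic
  · simp only [QuadraticMap.Anisotropic, not_forall] at h
    obtain ⟨⟨y, t⟩, hyt, h0⟩ := h
    have e : Q y = x * (t * t) := by
      simp only [perpNegUnary, prod_apply, smul_apply, sq_apply, smul_eq_mul] at hyt
      linear_combination hyt
    have ht : t ≠ 0 := by
      rintro rfl
      exact h0 (by rw [hQa y (by rw [e]; ring)]; rfl)
    refine ⟨t⁻¹ • y, ?_⟩
    rw [QuadraticMap.map_smul, e, smul_eq_mul]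
    field_simp
  · obtain ⟨y, -, hy, -⟩ := exists_polar_eq_zero_of_not_anisotropic hQ hQa x
    exact ⟨y, hy⟩

end Isotropy

end QForm
end

/-! ### The equivalences. -/

open QForm TensorProduct

theorem theorem2 {F : Type u} [Field F] [Invertible (2 : F)]
    {V : Type v} [AddCommGroup V] [Module F V] [FiniteDimensional F V]
    {W : Type w} [AddCommGroup W] [Module F W] [FiniteDimensional F W]
    (p : QuadraticForm F V) (q : QuadraticForm F W)
    (hp : p.Nondegenerate) (hq : q.Nondegenerate)
    (hdp : 2 ≤ Module.finrank F V) (hdq : 2 ≤ Module.finrank F W) :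
    List.TFAE [
      QForm.IsHyperbolic (q.baseChange (QForm.functionField p)),
      ∀ (K : Type u) [Field K] [Algebra F K],
        QForm.H (p.baseChange K) ⊆ QForm.G (q.baseChange K),
      QForm.IsHyperbolic
        ((QForm.perpNeg (QForm.laurentX F) (q.baseChange (LaurentSeries F))).baseChange
          (QForm.functionField
            (QForm.perpNeg (QForm.laurentX F) (p.baseChange (LaurentSeries F)))))] ∧
    ((1 : Fˣ) ∈ QForm.D p →
      List.TFAE [
        QForm.IsHyperbolic (q.baseChange (QForm.functionField p)),
        ∀ (K : Type u) [Field K] [Algebra F K],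
          QForm.H (p.baseChange K) ⊆ QForm.G (q.baseChange K),
        QForm.IsHyperbolic
          ((QForm.perpNeg (QForm.laurentX F) (q.baseChange (LaurentSeries F))).baseChange
            (QForm.functionField
              (QForm.perpNeg (QForm.laurentX F) (p.baseChange (LaurentSeries F))))),
        ∀ (K : Type u) [Field K] [Algebra F K],
          QForm.D (p.baseChange K) ⊆ QForm.G (q.baseChange K),
        QForm.IsHyperbolic
          ((QForm.perpNeg (QForm.laurentX F) (q.baseChange (LaurentSeries F))).baseChange
            (QForm.functionField
              (QForm.perpNegUnary (p.baseChange (LaurentSeries F)) (QForm.laurentX F))))]) := by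
  obtain ⟨w, hw, ew⟩ := exists_diag_equivalent hp
  have hx : laurentX F ≠ 0 := laurentX_ne_zero
  have hp' := nondegenerate_baseChange (E := LaurentSeries F) hp
  have hP := nondegenerate_prod hp' (nondegenerate_smul hp' (neg_ne_zero.2 hx))
  have hlaurent {K : Type u} [Field K] [Algebra F K] (hK : ¬ (p.baseChange K).Anisotropic)
      [Algebra (LaurentSeries F) (LaurentSeries K)]
      (halg : algebraMap (LaurentSeries F) (LaurentSeries K) = laurentMap (algebraMap F K)) :
      ¬ (diag (algebraMap (LaurentSeries F) (LaurentSeries K) ∘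
        algebraMap F (LaurentSeries F) ∘ w)).Anisotropic := by
    rw [anisotropic_congr (baseChange_equivalent_diag K ew)] at hK
    have := not_anisotropic_of_injective (algebraMap K (LaurentSeries K)).injective hK
    have hc : algebraMap K (LaurentSeries K) ∘ (algebraMap F K ∘ w) =
        algebraMap (LaurentSeries F) (LaurentSeries K) ∘ algebraMap F (LaurentSeries F) ∘ w := by
      rw [halg]
      exact funext fun i => (laurentMap_algebraMap _ _).symm
    rwa [hc] at this
  have h12 : IsHyperbolic (q.baseChange (functionField p)) → ∀ (K : Type u) [Field K] [Algebra F K],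
      H (p.baseChange K) ⊆ G (q.baseChange K) :=
    fun h K _ _ => H_subset_G hp hq hdp h K
  have h23 : (∀ (K : Type u) [Field K] [Algebra F K], H (p.baseChange K) ⊆ G (q.baseChange K)) →
      IsHyperbolic ((perpNeg (laurentX F) (q.baseChange (LaurentSeries F))).baseChange
        (functionField (perpNeg (laurentX F) (p.baseChange (LaurentSeries F))))) := by
    intro h
    -- Where `p ⊥ -xp` is isotropic, `x` belongs to `H_K(p)` by definition, so (ii) makes it a
    -- similarity factor of `q`.
    refine isHyperbolic_perpNeg_functionField hq hP
      (two_le_finrank_baseChange_prod hdp _) fun K _ _ _ _ hK => ?_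
    have hxK : algebraMap _ K (laurentX F) ≠ 0 := (map_ne_zero _).2 hx
    refine h K (a := Units.mk0 _ hxK) ?_
    change ¬ (perpNeg (algebraMap _ K (laurentX F)) _).Anisotropic
    rw [anisotropic_congr (perpNeg_baseChange_equivalent ew _)] at hK
    rw [anisotropic_congr (perpNeg_equivalent _ (baseChange_equivalent_diag K ew)),
      IsScalarTower.algebraMap_eq F (LaurentSeries F) K]
    exact hK
  have h31 : IsHyperbolic ((perpNeg (laurentX F) (q.baseChange (LaurentSeries F))).baseChange
        (functionField (perpNeg (laurentX F) (p.baseChange (LaurentSeries F))))) →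
      IsHyperbolic (q.baseChange (functionField p)) := by
    refine isHyperbolic_functionField_of_laurent hp hq hdp hP
      (two_le_finrank_baseChange_prod hdp _) fun K _ _ hK _ halg => ?_
    rw [anisotropic_congr (perpNeg_baseChange_equivalent ew _)]
    exact perpNeg_not_anisotropic (hlaurent hK halg)
  refine ⟨?_, fun hone => ?_⟩
  · tfae_have 1 → 2 := h12
    tfae_have 2 → 3 := h23
    tfae_have 3 → 1 := h31
    tfae_finish
  · obtain ⟨v₀, hv₀⟩ := hone
    have hP' : (perpNegUnary (p.baseChange (LaurentSeries F)) (laurentX F)).Nondegenerate := by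
      refine nondegenerate_congr (perpNegUnary_equivalent
        (baseChange_equivalent_diag (LaurentSeries F) ew) (laurentX F)).symm
        ((nondegenerate_diag_iff _).2 ?_)
      rintro (i | i)
      · exact (map_ne_zero _).2 (hw i)
      · exact neg_ne_zero.2 hx
    tfae_have 1 → 2 := h12
    tfae_have 2 → 3 := h23
    tfae_have 3 → 1 := h31
    -- `D_K(p) ⊆ H_K(p)`: if `p(y) = a` and `p(v₀) = 1`, then `(y, v₀)` is a nontrivial zero of `p ⊥
    -- -ap`.
    tfae_have 2 → 4 := by
      intro h K _ _ a ha
      refine h K ?_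
      obtain ⟨y, hy⟩ := ha
      intro haniso
      have hv : p.baseChange K (1 ⊗ₜ v₀) = 1 := by
        rw [QuadraticForm.baseChange_tmul, hv₀]; simp
      have h0 := haniso (y, 1 ⊗ₜ v₀) (by simp [perpNeg, hy, hv])
      have h1 : (1 : K) ⊗ₜ[F] v₀ = 0 := congrArg Prod.snd h0
      rw [h1, QuadraticMap.map_zero] at hv
      exact zero_ne_one hv
    -- Where `p ⊥ ⟨-x⟩` is isotropic, `p` represents `x`, so (iv) makes `x` a similarity factor of
    -- `q`.
    tfae_have 4 → 5 := by
      intro h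
      refine isHyperbolic_perpNeg_functionField hq hP' (two_le_finrank_baseChange_prod hdp _) fun K _ _ _ _ hK => ?_
      have hxK : algebraMap _ K (laurentX F) ≠ 0 := (map_ne_zero _).2 hx
      let : Invertible (2 : K) := invertibleTwo F K
      refine h K (a := Units.mk0 _ hxK) ?_
      change ∃ y, p.baseChange K y = algebraMap _ K (laurentX F)
      refine exists_eq_of_perpNegUnary_not_anisotropic (nondegenerate_baseChange hp) ?_
      rw [anisotropic_congr (perpNegUnary_baseChange_equivalent ew _)] at hK
      have e1 := baseChange_equivalent_diag K ew
      rw [IsScalarTower.algebraMap_eq F (LaurentSeries F) K] at e1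
      have e2 : (perpNegUnary (p.baseChange K) (algebraMap _ K (laurentX F))).Equivalent _ :=
        e1.prod (.refl _)
      rw [anisotropic_congr e2]
      exact hK
    tfae_have 5 → 1 := by
      refine isHyperbolic_functionField_of_laurent hp hq hdp hP' (two_le_finrank_baseChange_prod hdp _) fun K _ _ hK _ halg => ?_
      rw [anisotropic_congr (perpNegUnary_baseChange_equivalent ew _)]
      exact perpNegUnary_not_anisotropic (hlaurent hK halg)
    tfae_finish
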